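/- For a random variable $X$ and a non-decreasing $g:[0,\infty)\to[0,\infty)$ put $\|X\|_g=\inf\{\eta>0:\mathbb E[g(|X|/\eta)]\le 1\}$. For $\alpha>0$, $L\ge 0$ let $\phi_{\alpha,L}(x)=\exp(\min\{x^2,(x/L)^\alpha\})-1$, with $\phi_{\alpha,0}(x)=\exp(x^2)-1$. For $L=(L_1,\dots,L_n)$ with $L_i\ge 0$ let $\mathcal X_{\alpha,L}$ be the collection of all $(X_1,\dots,X_n)$ of independent real random variables with $\mathbb E[X_i]=0$ and $\|X_i\|_{\phi_{\alpha,L_i}}\le 1$. Write $\bar L_i=\max\{1,L_i\}$, $(a\odot L)_i=a_iL_i$, and $\beta=\frac{\alpha}{\alpha-1}$ if $\alpha>1$, $\beta=\infty$ if $\alpha\le 1$. Theorem. For every $\alpha>0$ there is a constant $C(\alpha)>0$, depending only on $\alpha$, such that for all $n$, all $a\in\mathbb R^n$ and all $L\in[0,\infty)^n$, with $$L^*:=C(\alpha)\,\frac{\|a\odot L\|_\beta}{\|a\odot\bar L\|_2},$$ one has $$\sup_{(X_1,\dots,X_n)\in\mathcal X_{\alpha,L}}\Big\|\sum_{i=1}^n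 a_iX_i\Big\|_{\phi_{\alpha,L^*}}\le C(\alpha)\,\|a\odot\bar L\|_2 ,$$ and, if $\alpha\le 2$, the bound is tight in the sense that $$\sup_{(X_1,\dots,X_n)\in\mathcal X_{\alpha,L}}\Big\|\sum_{i=1}^n a_iX_i\Big\|_{\phi_{\alpha,L^*}}\ge \frac1{C(\alpha)}\,\|a\odot\bar L\|_2 .$$ (If $a=0$, read $L^*=0$; both bounds are then trivial.) -/

import Mathlib

open MeasureTheory ProbabilityTheory
open scoped ENNReal

universe u

noncomputable section

/-- The Generalized Bernstein-Orlicz function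
`φ_{α,L}(x) = exp (min {x ^ 2, (x / L) ^ α}) - 1` for `x ≥ 0` and `L ≥ 0`.
For `L = 0` the quotient `x / L` is read as `+∞` (the limit `L → 0+`), so that
`φ_{α,0}(x) = exp (x ^ 2) - 1`. -/
def gboFun (α L x : ℝ) : ℝ :=
  if L = 0 then Real.exp (x ^ 2) - 1
  else Real.exp (min (x ^ 2) ((x / L) ^ α)) - 1

/-- The `g`-Orlicz norm `inf {η > 0 : E[g(|X| / η)] ≤ 1}` of a random variable, with values
in `[0, ∞]`; it is `∞` when there is no admissible `η`. -/
def orliczNorm {Ω : Type u} [MeasurableSpace Ω] (g : ℝ → ℝ) (X : Ω → ℝ) (P : Measure Ω) :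
    ℝ≥0∞ :=
  ⨅ (η : ℝ) (_ : 0 < η) (_ : ∫⁻ ω, ENNReal.ofReal (g (|X ω| / η)) ∂P ≤ 1), ENNReal.ofReal η

/-- The class `Φ_{α,L}(η)` of mean zero random variables with `‖X‖_{φ_{α,L}} ≤ η`. -/
structure IsSubWeibull {Ω : Type u} [MeasurableSpace Ω] (α L η : ℝ) (X : Ω → ℝ)
    (P : Measure Ω) : Prop where
  measurable : Measurable X
  integrable : Integrable X P
  mean_zero : ∫ ω, X ω ∂P = 0
  norm_le : orliczNorm (gboFun α L) X P ≤ ENNReal.ofReal η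

/-- The class `𝒳_{α,L}` of tuples of independent random variables `X_i ∈ Φ_{α,L_i}(1)`. -/
structure SubWeibullTuple {Ω : Type u} [MeasurableSpace Ω] {n : ℕ} (α : ℝ) (L : Fin n → ℝ)
    (X : Fin n → Ω → ℝ) (P : Measure Ω) : Prop where
  mem : ∀ i, IsSubWeibull α (L i) 1 (X i) P
  indep : iIndepFun X P

/-- The supremum of `‖∑ i, a_i X_i‖_{φ_{α,M}}` over all `(X_1, …, X_n) ∈ 𝒳_{α,L}`, on all
probability spaces. -/
def supGBONorm {n : ℕ} (α : ℝ) (a L : Fin n → ℝ) (M : ℝ) : ℝ≥0∞ :=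
  sSup {v : ℝ≥0∞ | ∃ (Ω : Type u) (_ : MeasurableSpace Ω) (P : Measure Ω)
    (_ : IsProbabilityMeasure P) (X : Fin n → Ω → ℝ), SubWeibullTuple α L X P ∧
      v = orliczNorm (gboFun α M) (fun ω => ∑ i, a i * X i ω) P}

/-- The exponent `β = α / (α - 1)` for `α > 1` and `β = ∞` for `α ≤ 1`. -/
def betaExp (α : ℝ) : ℝ≥0∞ :=
  if α ≤ 1 then ∞ else ENNReal.ofReal (α / (α - 1))

/-- The `ℓ_p` norm of a vector, `p ∈ [1, ∞]`. -/
def vecNorm {n : ℕ} (p : ℝ≥0∞) (v : Fin n → ℝ) : ℝ :=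
  ‖WithLp.toLp p v‖

/-- `‖a ⊙ L‖_β`. -/
def weightedBetaNorm {n : ℕ} (α : ℝ) (a L : Fin n → ℝ) : ℝ :=
  vecNorm (betaExp α) (fun i => a i * L i)

/-- `‖a ⊙ L̄‖₂`, where `L̄_i = max {1, L_i}`. -/
def weightedTwoNorm {n : ℕ} (a L : Fin n → ℝ) : ℝ :=
  vecNorm 2 (fun i => a i * max 1 (L i))

end

/-! ### Elementary inequalities -/

/-! Write `σ = ‖a ⊙ L̄‖₂`, `B = ‖a ⊙ L‖_β` and `S = ∑ a_i X_i`.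

Upper bound. Everything reduces to a tail `P(|S| ≥ x) ≤ K exp(-c min{(x/σ)², (x/B)^α})`, with only
the square if `B = 0`; integrating it (`exists_lintegral_exp_le`) and taking `C` large brings the
Orlicz integral below `1` (`exists_orliczNorm_le`). For `α ≤ 2`, cutting `X_i` according to the
active term of the minimum gives `X_i = 2 (U_i + L_i V_i)`, where `exp(U_i²)` and `exp(|V_i|^α)`
have expectation at most `2`. After centering, `∑ a_i U_i` is sub-Gaussian at scale `‖a‖₂ ≤ σ`, and
`∑ a_i L_i V_i` has the mixed tail. If `1 < α ≤ 2`, this is Chernoff's bound: the logarithm of the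
moment generating function is at most a multiple of `t² + |t|^β`, and summing over `i` produces
precisely the `ℓ₂` and `ℓ_β` norms (`exists_upper_tail_of_one_lt`). If `α ≤ 1`, exponential moments
can be infinite; the variables are truncated at level `x`, and a union bound pays for one big jump,
which is governed by the largest coefficient (`exists_upper_tail_of_le_one`). For `α ≥ 2`, each `X_i
/ L̄_i` is already sub-Gaussian, and the minimum is at most the square.

Lower bound. If the target exponent is purely quadratic, signs scaled by `L̄_i` have second moment
of order `σ²`, which is enough. Otherwise the Weibull term is active at infinity, and the norm is
decided by arbitrarily remote values: three-point variables placed in the proportions that attain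
equality in Hölder's inequality give `S = t B` with probability at least `2^{-n} exp(-t^α)`. The
rate `(x / (η L*))^α` matches this at `η = B / L* = σ / C`; for smaller `η` the integral diverges as
`t → ∞`, so the factor `2^{-n}` costs nothing (`le_supGBONorm_of_weightedBetaNorm_pos`). -/

lemma exp_le_one_add_add_sq_mul_exp_abs (x : ℝ) :
    Real.exp x ≤ 1 + x + x ^ 2 * Real.exp |x| := by
  have h := Complex.norm_exp_sub_sum_le_norm_mul_exp (x : ℂ) 2
  have h2 : Complex.exp x - ∑ m ∈ Finset.range 2, (x : ℂ) ^ m / (m.factorial : ℂ)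
      = ((Real.exp x - (1 + x) : ℝ) : ℂ) := by
    simp [Finset.sum_range_succ]
  rw [h2, Complex.norm_real, Complex.norm_real, Real.norm_eq_abs, Real.norm_eq_abs, sq_abs] at h
  linarith [le_abs_self (Real.exp x - (1 + x))]

lemma exp_half_lt : Real.exp (1 / 2) < 2 := by
  have h5 : Real.exp (1 / 2) ^ 2 = Real.exp 1 := by
    rw [← Real.exp_nat_mul]; norm_num
  have := Real.exp_one_lt_d9
  nlinarith [Real.exp_pos (1 / 2)]

/-- Convexity of `exp` between `0` and `x`. Through it a large scaling constant shrinks an Orlicz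
integral linearly. -/
lemma exp_mul_sub_one_le {ε x : ℝ} (h0 : 0 ≤ ε) (h1 : ε ≤ 1) :
    Real.exp (ε * x) - 1 ≤ ε * (Real.exp x - 1) := by
  have h := convexOn_exp.2 (Set.mem_univ x) (Set.mem_univ 0) h0 (sub_nonneg.2 h1) (by ring)
  simp only [smul_eq_mul, mul_zero, add_zero, Real.exp_zero, mul_one] at h
  linarith

lemma abs_rpow_two_div {α : ℝ} (hα : 0 < α) (y : ℝ) : (|y| ^ α) ^ (2 / α) = y ^ 2 := by
  rw [← Real.rpow_mul (abs_nonneg y), mul_div_cancel₀ _ hα.ne', Real.rpow_two, sq_abs]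

/-- `y ^ 2` is absorbed by half of the exponential moment. -/
lemma exists_sq_mul_exp_half_le {α : ℝ} (hα : 0 < α) :
    ∃ K : ℝ, 0 < K ∧ ∀ y : ℝ,
      y ^ 2 * Real.exp (|y| ^ α / 2) ≤ K * Real.exp (|y| ^ α) := by
  set s := 2 / α with hs
  have hs0 : 0 < s := by positivity
  refine ⟨(2 * s) ^ s, by positivity, fun y => ?_⟩
  set v := |y| ^ α with hv
  have hv0 : 0 ≤ v := by positivity
  -- Here `y ^ 2 = v ^ s`, so the rate `1 / (2 s)` is the one whose `s`-th power gives `exp (v /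
  -- 2)`.
  have h1 : v ≤ 2 * s * Real.exp (v / (2 * s)) := by
    have := Real.add_one_le_exp (v / (2 * s))
    have h2 : v / (2 * s) ≤ Real.exp (v / (2 * s)) := by linarith
    calc v = 2 * s * (v / (2 * s)) := by field_simp
      _ ≤ _ := by gcongr
  have h2 : y ^ 2 ≤ (2 * s) ^ s * Real.exp (v / 2) := by
    rw [← abs_rpow_two_div hα y, ← hv, ← hs]
    calc v ^ s ≤ (2 * s * Real.exp (v / (2 * s))) ^ s := by gcongr
      _ = (2 * s) ^ s * Real.exp (v / (2 * s)) ^ s := by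
          rw [Real.mul_rpow (by positivity) (by positivity)]
      _ = (2 * s) ^ s * Real.exp (v / 2) := by
          rw [← Real.exp_mul]; congr 2; field_simp
  calc y ^ 2 * Real.exp (v / 2) ≤ (2 * s) ^ s * Real.exp (v / 2) * Real.exp (v / 2) := by gcongr
    _ = (2 * s) ^ s * Real.exp v := by rw [mul_assoc, ← Real.exp_add, add_halves]

/-! ### Exponential moments -/

/-- `Y` is measurable and `E exp (|Y| ^ α) ≤ D`. -/
structure HasExpMoment {Ω : Type u} [MeasurableSpace Ω] (α D : ℝ) (Y : Ω → ℝ)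
    (P : Measure Ω) : Prop where
  measurable : Measurable Y
  integrable_exp : Integrable (fun ω => Real.exp (|Y ω| ^ α)) P
  integral_exp_le : ∫ ω, Real.exp (|Y ω| ^ α) ∂P ≤ D

/-- `Y ^ 2 exp (|Y| ^ α / 2)`. -/
noncomputable def expWeight {Ω : Type u} (α : ℝ) (Y : Ω → ℝ) (ω : Ω) : ℝ :=
  Y ω ^ 2 * Real.exp (|Y ω| ^ α / 2)

section

variable {Ω : Type u} {α : ℝ}

lemma expWeight_nonneg (Y : Ω → ℝ) (ω : Ω) : 0 ≤ expWeight α Y ω := by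
  unfold expWeight; positivity

lemma sq_le_expWeight (Y : Ω → ℝ) (ω : Ω) : Y ω ^ 2 ≤ expWeight α Y ω :=
  le_mul_of_one_le_right (sq_nonneg _) (Real.one_le_exp (by positivity))

variable [MeasurableSpace Ω] {P : Measure Ω} {D : ℝ} {Y : Ω → ℝ}

lemma HasExpMoment.neg (h : HasExpMoment α D Y P) : HasExpMoment α D (fun ω => -Y ω) P :=
  ⟨h.measurable.neg, by simpa using h.integrable_exp, by simpa using h.integral_exp_le⟩

lemma HasExpMoment.of_le {f : Ω → ℝ} (hY : Measurable Y) (hf : Integrable f P)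
    (hfD : ∫ ω, f ω ∂P ≤ D) (hle : ∀ ω, Real.exp (|Y ω| ^ α) ≤ f ω) : HasExpMoment α D Y P := by
  have hi : Integrable (fun ω => Real.exp (|Y ω| ^ α)) P := by
    refine hf.mono' (by fun_prop : Measurable _).aestronglyMeasurable
      (Filter.Eventually.of_forall fun ω => ?_)
    rw [Real.norm_of_nonneg (by positivity)]
    exact hle ω
  exact ⟨hY, hi, (integral_mono hi hf hle).trans hfD⟩

/-- Control of the weight by the exponential moment. -/
lemma exists_integral_expWeight_le (hα : 0 < α) (D : ℝ) :
    ∃ M : ℝ, 0 < M ∧ ∀ {Ω : Type u} [MeasurableSpace Ω] {P : Measure Ω} [IsProbabilityMeasure P]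
      {Y : Ω → ℝ}, HasExpMoment α D Y P →
      Integrable (expWeight α Y) P ∧ ∫ ω, expWeight α Y ω ∂P ≤ M ∧ Integrable Y P ∧ 1 ≤ D := by
  obtain ⟨K, hK, hle⟩ := exists_sq_mul_exp_half_le hα
  refine ⟨K * max D 1, by positivity, fun {Ω} _ P _ Y h => ?_⟩
  have hm := h.measurable
  have hi : Integrable (expWeight α Y) P := by
    refine (h.integrable_exp.const_mul K).mono' ?_ (Filter.Eventually.of_forall fun ω => ?_)
    · unfold expWeight; fun_prop
    · rw [Real.norm_of_nonneg (expWeight_nonneg Y ω)]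
      exact hle _
  refine ⟨hi, ?_, ?_, ?_⟩
  · calc ∫ ω, expWeight α Y ω ∂P ≤ ∫ ω, K * Real.exp (|Y ω| ^ α) ∂P :=
          integral_mono hi (h.integrable_exp.const_mul K) fun ω => hle _
      _ = K * ∫ ω, Real.exp (|Y ω| ^ α) ∂P := integral_const_mul _ _
      _ ≤ K * max D 1 := by
          have := h.integral_exp_le.trans (le_max_left D 1)
          gcongr
  · refine ((integrable_const 1).add hi).mono' hm.aestronglyMeasurable
      (Filter.Eventually.of_forall fun ω => ?_)
    have := sq_le_expWeight (α := α) Y ω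
    simp only [Real.norm_eq_abs, Pi.add_apply]
    have h2 := sq_nonneg (|Y ω| - 1)
    nlinarith [sq_abs (Y ω), abs_nonneg (Y ω)]
  · calc (1 : ℝ) = ∫ _, 1 ∂P := by simp
      _ ≤ ∫ ω, Real.exp (|Y ω| ^ α) ∂P :=
          integral_mono (integrable_const 1) h.integrable_exp
            fun ω => Real.one_le_exp (by positivity)
      _ ≤ D := h.integral_exp_le

lemma abs_sub_div_two_rpow_le (hα : 0 < α) (x e : ℝ) :
    Real.exp (|(x - e) / 2| ^ α) ≤ Real.exp (|x| ^ α) + Real.exp (|e| ^ α) := by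
  have h : |(x - e) / 2| ≤ max |x| |e| := by
    rw [abs_div, abs_two]
    have := abs_sub x e
    have := le_max_left |x| |e|
    have := le_max_right |x| |e|
    linarith
  rcases le_total |x| |e| with hc | hc
  · rw [max_eq_right hc] at h
    have : Real.exp (|(x - e) / 2| ^ α) ≤ Real.exp (|e| ^ α) := by gcongr
    linarith [Real.exp_pos (|x| ^ α)]
  · rw [max_eq_left hc] at h
    have : Real.exp (|(x - e) / 2| ^ α) ≤ Real.exp (|x| ^ α) := by gcongr
    linarith [Real.exp_pos (|e| ^ α)]

/-- Centering keeps exponential moments bounded. -/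
lemma exists_hasExpMoment_center (hα : 0 < α) (D : ℝ) :
    ∃ D' : ℝ, ∀ {Ω : Type u} [MeasurableSpace Ω] {P : Measure Ω} [IsProbabilityMeasure P]
      {Y : Ω → ℝ}, HasExpMoment α D Y P →
      HasExpMoment α D' (fun ω => (Y ω - ∫ ω, Y ω ∂P) / 2) P := by
  obtain ⟨M, hM, hW⟩ := exists_integral_expWeight_le.{u} hα D
  -- The second summand pays for the mean: `|Y| ≤ 1 + Y ^ 2 ≤ 1 + expWeight` gives `|E Y| ≤ 1 + M`.
  refine ⟨D + Real.exp ((1 + M) ^ α), fun {Ω} _ P _ Y h => ?_⟩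
  obtain ⟨hi, hle, hY, -⟩ := hW h
  have he : |∫ ω, Y ω ∂P| ≤ 1 + M := by
    calc |∫ ω, Y ω ∂P| ≤ ∫ ω, |Y ω| ∂P := abs_integral_le_integral_abs
      _ ≤ ∫ ω, (1 + expWeight α Y ω) ∂P := by
          refine integral_mono hY.abs ((integrable_const 1).add hi) fun ω => ?_
          have := sq_le_expWeight (α := α) Y ω
          have h2 := sq_nonneg (|Y ω| - 1)
          simp only
          nlinarith [sq_abs (Y ω), abs_nonneg (Y ω)]
      _ = 1 + ∫ ω, expWeight α Y ω ∂P := by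
          rw [integral_add (integrable_const 1) hi]; simp
      _ ≤ 1 + M := by linarith
  have hm := h.measurable
  refine HasExpMoment.of_le (f := fun ω => Real.exp (|Y ω| ^ α) + Real.exp ((1 + M) ^ α))
    (by fun_prop) (h.integrable_exp.add (integrable_const _)) ?_ fun ω => ?_
  · rw [integral_add h.integrable_exp (integrable_const _)]
    simpa using h.integral_exp_le
  · refine (abs_sub_div_two_rpow_le hα _ _).trans ?_
    gcongr

end

/-! ### Tails of weighted sums of independent variables -/

section

variable {Ω : Type u} [MeasurableSpace Ω] {P : Measure Ω} [IsProbabilityMeasure P] {n : ℕ}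

/-- Chernoff's bound for sums of independent variables. -/
lemma measureReal_le_sum_le_exp {Z : Fin n → Ω → ℝ} (hind : iIndepFun Z P)
    (hm : ∀ i, Measurable (Z i)) {t : ℝ} (ht : 0 ≤ t) {κ : Fin n → ℝ}
    (hint : ∀ i, Integrable (fun ω => Real.exp (t * Z i ω)) P)
    (hle : ∀ i, ∫ ω, Real.exp (t * Z i ω) ∂P ≤ Real.exp (κ i)) (x : ℝ) :
    P.real {ω | x ≤ ∑ i, Z i ω} ≤ Real.exp (-(t * x) + ∑ i, κ i) := by
  have h1 := hind.integrable_exp_mul_sum hm (s := Finset.univ) (t := t) fun i _ => hint i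
  have h2 := measure_ge_le_exp_mul_mgf x ht h1
  rw [hind.mgf_sum hm] at h2
  simp only [Finset.sum_apply] at h2
  refine h2.trans ?_
  rw [Real.exp_add, Real.exp_sum, neg_mul]
  gcongr with i _
  · exact fun i _ => mgf_nonneg
  · exact hle i

/-- A pointwise bound of `exp Z` by `1 + u Y + v W` with `E Y = 0` bounds `E exp Z`. -/
lemma integral_exp_le_of_le_affine {u v M : ℝ} {Y W Z : Ω → ℝ} (hZ : Measurable Z)
    (hi : Integrable Y P) (h0 : ∫ ω, Y ω ∂P = 0) (hW : Integrable W P)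
    (hM : ∫ ω, W ω ∂P ≤ M) (hv : 0 ≤ v)
    (hle : ∀ ω, Real.exp (Z ω) ≤ 1 + u * Y ω + v * W ω) :
    Integrable (fun ω => Real.exp (Z ω)) P ∧ ∫ ω, Real.exp (Z ω) ∂P ≤ Real.exp (v * M) := by
  have h1 : Integrable (fun ω => 1 + u * Y ω) P := (integrable_const 1).add (hi.const_mul u)
  have hd : Integrable (fun ω => 1 + u * Y ω + v * W ω) P := h1.add (hW.const_mul v)
  have hint : Integrable (fun ω => Real.exp (Z ω)) P := by
    refine hd.mono' hZ.exp.aestronglyMeasurable (Filter.Eventually.of_forall fun ω => ?_)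
    rw [Real.norm_of_nonneg (by positivity)]
    exact hle ω
  refine ⟨hint, ?_⟩
  calc ∫ ω, Real.exp (Z ω) ∂P ≤ ∫ ω, (1 + u * Y ω + v * W ω) ∂P := integral_mono hint hd hle
    _ = 1 + v * ∫ ω, W ω ∂P := by
        rw [integral_add h1 (hW.const_mul v), integral_add (integrable_const 1) (hi.const_mul u),
          integral_const_mul, integral_const_mul, h0]
        simp
    _ ≤ 1 + v * M := by gcongr
    _ ≤ _ := by
        have := Real.add_one_le_exp (v * M)
        linarith

/-- Second-order Taylor expansion, whose linear term has mean zero. Since `|Y| ≤ 1 + |Y| ^ α`, the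
remainder factor `exp |t Y|` is at most `2 exp (|Y| ^ α / 2)`, which `expWeight` absorbs. -/
lemma integral_exp_mul_le_of_abs_le {α M t : ℝ} (hα : 1 ≤ α) (ht : |t| ≤ 1 / 2) {Y : Ω → ℝ}
    (hY : Measurable Y) (hi : Integrable Y P) (h0 : ∫ ω, Y ω ∂P = 0)
    (hW : Integrable (expWeight α Y) P) (hM : ∫ ω, expWeight α Y ω ∂P ≤ M) :
    Integrable (fun ω => Real.exp (t * Y ω)) P ∧
      ∫ ω, Real.exp (t * Y ω) ∂P ≤ Real.exp (2 * M * t ^ 2) := by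
  have hle : ∀ ω, Real.exp (t * Y ω) ≤ 1 + t * Y ω + 2 * t ^ 2 * expWeight α Y ω := fun ω => by
    have h1 := exp_le_one_add_add_sq_mul_exp_abs (t * Y ω)
    have h2 : |Y ω| ≤ 1 + |Y ω| ^ α := by
      rcases le_total |Y ω| 1 with h | h
      · have : 0 ≤ |Y ω| ^ α := by positivity
        linarith
      · have := Real.rpow_le_rpow_of_exponent_le h hα
        rw [Real.rpow_one] at this
        linarith
    have h3 : |t * Y ω| ≤ 1 / 2 + |Y ω| ^ α / 2 := by
      rw [abs_mul]
      calc |t| * |Y ω| ≤ 1 / 2 * (1 + |Y ω| ^ α) := by gcongr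
        _ = _ := by ring
    have h4 : Real.exp |t * Y ω| ≤ 2 * Real.exp (|Y ω| ^ α / 2) := by
      calc Real.exp |t * Y ω| ≤ Real.exp (1 / 2 + |Y ω| ^ α / 2) := by gcongr
        _ = Real.exp (1 / 2) * Real.exp (|Y ω| ^ α / 2) := Real.exp_add _ _
        _ ≤ _ := by
          gcongr
          exact exp_half_lt.le
    have h6 : (t * Y ω) ^ 2 * Real.exp |t * Y ω|
        ≤ (t * Y ω) ^ 2 * (2 * Real.exp (|Y ω| ^ α / 2)) := by gcongr
    unfold expWeight
    nlinarith
  have h := integral_exp_le_of_le_affine (hY.const_mul t) hi h0 hW hM (by positivity) hle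
  rwa [mul_right_comm] at h

/-- The moment generating function bound `E exp (t Y) ≤ exp (M (t ^ 2 + |t| ^ β))`, where `β` is
conjugate to `α`. -/
lemma exists_integral_exp_mul_le {α β : ℝ} (hαβ : α.HolderConjugate β) (D : ℝ) :
    ∃ M : ℝ, 0 < M ∧ ∀ {Ω : Type u} [MeasurableSpace Ω] {P : Measure Ω} [IsProbabilityMeasure P]
      {Y : Ω → ℝ}, HasExpMoment α D Y P → ∫ ω, Y ω ∂P = 0 → ∀ t : ℝ,
      Integrable (fun ω => Real.exp (t * Y ω)) P ∧
      ∫ ω, Real.exp (t * Y ω) ∂P ≤ Real.exp (M * (t ^ 2 + |t| ^ β)) := by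
  obtain ⟨M, hM, hW⟩ := exists_integral_expWeight_le.{u} hαβ.pos D
  have hN : 0 < 2 * M + 1 + 4 * |Real.log D| := by positivity
  refine ⟨2 * M + 1 + 4 * |Real.log D|, hN, fun {Ω} _ P _ Y h h0 t => ?_⟩
  obtain ⟨hi, hle, hY, hD⟩ := hW h
  have hm := h.measurable
  have htb : 0 ≤ |t| ^ β := by positivity
  have hl := abs_nonneg (Real.log D)
  -- Small `t` uses centering. Large `t` uses only Young's inequality; the resulting factor `D` is
  -- then harmless, because `t ^ 2 ≥ 1 / 4` turns `log D` into a multiple of `t ^ 2`.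
  rcases le_total |t| (1 / 2) with ht | ht
  · obtain ⟨h1, h2⟩ := integral_exp_mul_le_of_abs_le hαβ.lt.le ht hm hY h0 hi hle
    refine ⟨h1, h2.trans (Real.exp_le_exp.2 ?_)⟩
    have : 0 ≤ (1 + 4 * |Real.log D|) * t ^ 2 := by positivity
    have : 0 ≤ (2 * M + 1 + 4 * |Real.log D|) * |t| ^ β := by positivity
    linarith
  · have hp : ∀ ω, Real.exp (t * Y ω) ≤ Real.exp (|t| ^ β) * Real.exp (|Y ω| ^ α) := fun ω => by
      rw [← Real.exp_add]
      refine Real.exp_le_exp.2 ?_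
      have h1 := Real.young_inequality_of_nonneg (abs_nonneg (Y ω)) (abs_nonneg t) hαβ
      have h2 : |Y ω| ^ α / α ≤ |Y ω| ^ α := div_le_self (by positivity) hαβ.lt.le
      have h3 : |t| ^ β / β ≤ |t| ^ β := div_le_self htb hαβ.symm.lt.le
      have h4 := le_abs_self (t * Y ω)
      rw [abs_mul] at h4
      linarith
    have hd := h.integrable_exp.const_mul (Real.exp (|t| ^ β))
    have hint : Integrable (fun ω => Real.exp (t * Y ω)) P := by
      refine hd.mono' (by fun_prop : Measurable _).aestronglyMeasurable
        (Filter.Eventually.of_forall fun ω => ?_)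
      rw [Real.norm_of_nonneg (by positivity)]
      exact hp ω
    refine ⟨hint, ?_⟩
    calc ∫ ω, Real.exp (t * Y ω) ∂P ≤ ∫ ω, Real.exp (|t| ^ β) * Real.exp (|Y ω| ^ α) ∂P :=
          integral_mono hint hd hp
      _ ≤ Real.exp (|t| ^ β) * D := by
          rw [integral_const_mul]
          gcongr
          exact h.integral_exp_le
      _ = Real.exp (|t| ^ β + Real.log D) := by
          rw [Real.exp_add, Real.exp_log (by linarith)]
      _ ≤ _ := by
          refine Real.exp_le_exp.2 ?_
          have h5 : 1 / 4 ≤ t ^ 2 := by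
            rw [← sq_abs]; nlinarith
          have h6 := le_abs_self (Real.log D)
          have h7 : |Real.log D| ≤ 4 * |Real.log D| * t ^ 2 := by nlinarith
          have h8 : 0 ≤ (2 * M + 4 * |Real.log D|) * |t| ^ β := by positivity
          have h9 : 0 ≤ (2 * M + 1) * t ^ 2 := by positivity
          linarith

/-- The truncated moment generating function bound for heavy tails. -/
lemma integral_exp_mul_truncate_le {α M t b x B : ℝ} (hα : 0 < α) (hα1 : α ≤ 1) (hx : 0 < x)
    (hB : 0 < B) (hb : |b| ≤ B) (ht : 0 ≤ t) (htx : t * x ≤ (x / B) ^ α / 2) {Y : Ω → ℝ}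
    (hY : Measurable Y) (hi : Integrable Y P) (h0 : ∫ ω, Y ω ∂P = 0)
    (hW : Integrable (expWeight α Y) P) (hM : ∫ ω, expWeight α Y ω ∂P ≤ M) :
    Integrable (fun ω => Real.exp (t * (if |b * Y ω| ≤ x then b * Y ω else 0))) P ∧
      ∫ ω, Real.exp (t * (if |b * Y ω| ≤ x then b * Y ω else 0)) ∂P
        ≤ Real.exp (M * b ^ 2 * (t ^ 2 + t / x)) := by
  have hle : ∀ ω, Real.exp (t * (if |b * Y ω| ≤ x then b * Y ω else 0))
      ≤ 1 + t * b * Y ω + b ^ 2 * (t ^ 2 + t / x) * expWeight α Y ω := fun ω => by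
    have hw := sq_le_expWeight (α := α) Y ω
    have hsq : b ^ 2 * (t / x) * Y ω ^ 2 ≤ b ^ 2 * (t / x) * expWeight α Y ω := by gcongr
    split_ifs with hc
    · have h1 := exp_le_one_add_add_sq_mul_exp_abs (t * (b * Y ω))
      -- The ratio `u = |b Y| / x` is at most `1` after truncation, so `u ≤ u ^ α` as `α ≤ 1`; the
      -- linear exponent becomes subordinate to `|Y| ^ α / 2`.
      have h3 : |t * (b * Y ω)| ≤ |Y ω| ^ α / 2 := by
        rw [abs_mul, abs_of_nonneg ht]
        have h4 : |b * Y ω| / x ≤ (|b * Y ω| / x) ^ α := by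
          conv_lhs => rw [← Real.rpow_one (|b * Y ω| / x)]
          exact Real.rpow_le_rpow_of_exponent_ge' (by positivity) ((div_le_one hx).2 hc) hα.le hα1
        calc t * |b * Y ω| = t * x * (|b * Y ω| / x) := by field_simp
          _ ≤ (x / B) ^ α / 2 * (|b * Y ω| / x) ^ α := by gcongr
          _ = (x / B * (|b * Y ω| / x)) ^ α / 2 := by
              rw [Real.mul_rpow (by positivity) (by positivity)]; ring
          _ ≤ |Y ω| ^ α / 2 := by
              gcongr
              rw [div_mul_div_comm, mul_comm B x, mul_div_mul_left _ _ hx.ne', abs_mul,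
                div_le_iff₀ hB, mul_comm |Y ω|]
              gcongr
      have h6 : (t * (b * Y ω)) ^ 2 * Real.exp |t * (b * Y ω)|
          ≤ (t * (b * Y ω)) ^ 2 * Real.exp (|Y ω| ^ α / 2) := by gcongr
      have h7 : 0 ≤ b ^ 2 * (t / x) * Y ω ^ 2 := by positivity
      have h8 : (t * (b * Y ω)) ^ 2 * Real.exp (|Y ω| ^ α / 2)
          = b ^ 2 * t ^ 2 * expWeight α Y ω := by
        unfold expWeight; ring
      linarith
    -- Truncation destroys the mean-zero property. Where `Y` is cut off, the missing linear term is
    -- dominated by `t (b Y) ^ 2 / x`, the source of the summand `t / x`.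
    · have h1 : |b * Y ω| ≤ (b * Y ω) ^ 2 / x := by
        rw [le_div_iff₀ hx, ← sq_abs, sq]
        gcongr
        exact (not_le.1 hc).le
      have h2 := neg_abs_le (b * Y ω)
      have h3 : 0 ≤ t * (b * Y ω + (b * Y ω) ^ 2 / x) := mul_nonneg ht (by linarith)
      have h4 : t * (b * Y ω + (b * Y ω) ^ 2 / x)
          = t * b * Y ω + b ^ 2 * (t / x) * Y ω ^ 2 := by ring
      have h5 : 0 ≤ b ^ 2 * t ^ 2 * expWeight α Y ω :=
        mul_nonneg (by positivity) (expWeight_nonneg Y ω)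
      rw [mul_zero, Real.exp_zero]
      linarith
  have h := integral_exp_le_of_le_affine
    (Measurable.const_mul (Measurable.ite (measurableSet_le (by fun_prop) measurable_const)
      (by fun_prop) measurable_const) t) hi h0 hW hM (by positivity) hle
  rwa [show b ^ 2 * (t ^ 2 + t / x) * M = M * b ^ 2 * (t ^ 2 + t / x) by ring] at h

end

/-- The upper tail of a sum of independent variables with `α ≤ 1`. -/
lemma exists_upper_tail_of_le_one {α : ℝ} (hα : 0 < α) (hα1 : α ≤ 1) (D : ℝ) :
    ∃ K c : ℝ, 0 < K ∧ 0 < c ∧ ∀ {Ω : Type u} [MeasurableSpace Ω] {P : Measure Ω}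
      [IsProbabilityMeasure P] {n : ℕ} {b : Fin n → ℝ} {Y : Fin n → Ω → ℝ} {σ B x : ℝ},
      (∀ i, HasExpMoment α D (Y i) P) → (∀ i, ∫ ω, Y i ω ∂P = 0) → iIndepFun Y P →
      0 < σ → 0 < B → ∑ i, b i ^ 2 ≤ σ ^ 2 → (∀ i, |b i| ≤ B) → 0 < x →
      P.real {ω | x ≤ ∑ i, b i * Y i ω}
        ≤ K * Real.exp (-(c * min ((x / σ) ^ 2) ((x / B) ^ α))) := by
  obtain ⟨M, hM, hW⟩ := exists_integral_expWeight_le.{u} hα D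
  -- Both `c ≤ 1 / 2` and `M c ≤ 1 / 2` are needed: the first makes `t x = c h` admissible for the
  -- truncated bound, the second keeps the summed exponents below half of `t x`, up to a constant.
  set c := 1 / (2 * (M + 1)) with hc
  have hc0 : 0 < c := by positivity
  have hMc : M * c ≤ 1 / 2 := by rw [hc]; field_simp; linarith
  have hc1 : c ≤ 1 / 2 := by rw [hc]; field_simp; linarith
  have he2 : Real.exp (1 / 2) ≤ 2 := exp_half_lt.le
  refine ⟨M + 2, c / 2, by positivity, by positivity, ?_⟩
  intro Ω _ P _ n b Y σ B x hY h0 hind hσ hB hbσ hbB hx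
  set h := min ((x / σ) ^ 2) ((x / B) ^ α) with hh
  have hh1 : h ≤ (x / σ) ^ 2 := min_le_left _ _
  have hh2 : h ≤ (x / B) ^ α := min_le_right _ _
  have hhpos : 0 < h := lt_min (by positivity) (by positivity)
  -- Below `σ` the claim is weaker than `P ≤ 1`. The big-jump estimate needs `x ≥ σ`.
  rcases lt_or_ge x σ with hxσ | hxσ
  · have h1 : h ≤ 1 := hh1.trans (pow_le_one₀ (by positivity) ((div_le_one hσ).2 hxσ.le))
    have h2 : 1 ≤ 2 * Real.exp (-(c / 2 * h)) := by
      rw [Real.exp_neg, ← div_eq_mul_inv, le_div_iff₀ (Real.exp_pos _), one_mul]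
      refine le_trans (Real.exp_le_exp.2 ?_) he2
      nlinarith
    have h3 : 0 ≤ M * Real.exp (-(c / 2 * h)) := by positivity
    have := measureReal_le_one (μ := P) (s := {ω | x ≤ ∑ i, b i * Y i ω})
    linarith
  set t := c * h / x with ht
  have ht0 : 0 < t := by positivity
  have htx : t * x = c * h := by rw [ht]; field_simp
  set Z : Fin n → Ω → ℝ := fun i ω => if |b i * Y i ω| ≤ x then b i * Y i ω else 0 with hZ
  have hZind : iIndepFun Z P :=
    hind.comp (fun i y => if |b i * y| ≤ x then b i * y else 0) fun i =>
      Measurable.ite (measurableSet_le (by fun_prop) measurable_const) (by fun_prop)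
        measurable_const
  have hYm := fun i => (hY i).measurable
  have hZm : ∀ i, Measurable (Z i) := fun i =>
    Measurable.ite (measurableSet_le (by fun_prop) measurable_const) (by fun_prop)
      measurable_const
  have hmgf := fun i => integral_exp_mul_truncate_le hα hα1 hx hB (hbB i) ht0.le
    (by rw [htx]; nlinarith) (hYm i) (hW (hY i)).2.2.1 (h0 i) (hW (hY i)).1 (hW (hY i)).2.1
  have hmain := measureReal_le_sum_le_exp hZind hZm ht0.le (fun i => (hmgf i).1)
    (fun i => (hmgf i).2) x
  have hsum : ∑ i, M * b i ^ 2 * (t ^ 2 + t / x) ≤ c * h / 2 + 1 / 2 := by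
    have h1 : t * σ ^ 2 ≤ c * x := by
      have : h * σ ^ 2 ≤ x ^ 2 := by
        calc h * σ ^ 2 ≤ (x / σ) ^ 2 * σ ^ 2 := by gcongr
          _ = x ^ 2 := by field_simp
      rw [ht, div_mul_eq_mul_div, div_le_iff₀ hx]
      nlinarith
    calc ∑ i, M * b i ^ 2 * (t ^ 2 + t / x) = M * (t ^ 2 + t / x) * ∑ i, b i ^ 2 := by
          rw [Finset.mul_sum]; exact Finset.sum_congr rfl fun i _ => by ring
      _ ≤ M * (t ^ 2 + t / x) * σ ^ 2 := by gcongr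
      _ = M * (t + 1 / x) * (t * σ ^ 2) := by ring
      _ ≤ M * (t + 1 / x) * (c * x) := by gcongr
      _ = M * c * (t * x + 1) := by field_simp
      _ ≤ 1 / 2 * (t * x + 1) := by gcongr
      _ = _ := by rw [htx]; ring
  have hmain2 : P.real {ω | x ≤ ∑ i, Z i ω} ≤ 2 * Real.exp (-(c / 2 * h)) := by
    refine hmain.trans ?_
    calc _ ≤ Real.exp (1 / 2 + -(c / 2 * h)) := by
          refine Real.exp_le_exp.2 ?_
          rw [htx]; linarith
      _ ≤ _ := by rw [Real.exp_add]; gcongr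
  -- Markov's inequality for `b_i ^ 2 * expWeight`, not for the bare exponential: the factor `b_i ^
  -- 2` makes the union bound summable against `σ ^ 2`, uniformly in `n`.
  have hbig : ∀ i, P.real {ω | x < |b i * Y i ω|}
      ≤ b i ^ 2 * (M / σ ^ 2 * Real.exp (-(c / 2 * h))) := fun i => by
    obtain ⟨hWi, hWM, -, -⟩ := hW (hY i)
    have hmark := mul_meas_ge_le_integral_of_nonneg
      (Filter.Eventually.of_forall fun ω => mul_nonneg (sq_nonneg (b i)) (expWeight_nonneg (Y i) ω))
      (hWi.const_mul (b i ^ 2)) (x ^ 2 * Real.exp (h / 2))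
    have hsub : P.real {ω | x < |b i * Y i ω|} ≤
        P.real {ω | x ^ 2 * Real.exp (h / 2) ≤ b i ^ 2 * expWeight α (Y i) ω} := by
      refine measureReal_mono fun ω hω => ?_
      simp only [Set.mem_ofPred_eq] at hω ⊢
      have h1 : x / B ≤ |Y i ω| := by
        rw [div_le_iff₀ hB, mul_comm]
        rw [abs_mul] at hω
        exact hω.le.trans (by gcongr; exact hbB i)
      have h2 : x ^ 2 ≤ (b i * Y i ω) ^ 2 := by
        rw [← sq_abs (b i * Y i ω)]; gcongr
      have h3 : h ≤ |Y i ω| ^ α := hh2.trans (by gcongr)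
      calc x ^ 2 * Real.exp (h / 2) ≤ (b i * Y i ω) ^ 2 * Real.exp (|Y i ω| ^ α / 2) := by gcongr
        _ = _ := by unfold expWeight; ring
    rw [integral_const_mul] at hmark
    have hx2 : 0 < x ^ 2 * Real.exp (h / 2) := by positivity
    have h4 : P.real {ω | x < |b i * Y i ω|} ≤ b i ^ 2 * M / (x ^ 2 * Real.exp (h / 2)) := by
      rw [le_div_iff₀ hx2, mul_comm]
      calc _ ≤ _ := mul_le_mul_of_nonneg_left hsub hx2.le
        _ ≤ _ := hmark
        _ ≤ _ := by gcongr
    refine h4.trans ?_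
    calc b i ^ 2 * M / (x ^ 2 * Real.exp (h / 2)) ≤ b i ^ 2 * M / (σ ^ 2 * Real.exp (c / 2 * h)) := by
          gcongr; nlinarith
      _ = _ := by rw [Real.exp_neg]; field_simp
  have hbigsum : ∑ i, P.real {ω | x < |b i * Y i ω|} ≤ M * Real.exp (-(c / 2 * h)) := by
    calc _ ≤ ∑ i, b i ^ 2 * (M / σ ^ 2 * Real.exp (-(c / 2 * h))) :=
          Finset.sum_le_sum fun i _ => hbig i
      _ = (∑ i, b i ^ 2) * (M / σ ^ 2 * Real.exp (-(c / 2 * h))) := by rw [Finset.sum_mul]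
      _ ≤ σ ^ 2 * (M / σ ^ 2 * Real.exp (-(c / 2 * h))) := by gcongr
      _ = _ := by field_simp
  have hsub : {ω | x ≤ ∑ i, b i * Y i ω}
      ⊆ {ω | x ≤ ∑ i, Z i ω} ∪ ⋃ i, {ω | x < |b i * Y i ω|} := fun ω hω => by
    by_cases hex : ∃ i, x < |b i * Y i ω|
    · exact Or.inr (Set.mem_iUnion.2 hex)
    · push Not at hex
      left
      have : ∑ i, Z i ω = ∑ i, b i * Y i ω :=
        Finset.sum_congr rfl fun i _ => if_pos (hex i)
      simpa only [Set.mem_ofPred_eq, this] using hω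
  calc _ ≤ _ := measureReal_mono hsub
    _ ≤ _ := measureReal_union_le _ _
    _ ≤ _ := add_le_add_right (measureReal_iUnion_fintype_le _) _
    _ ≤ _ := by linarith

/-- The upper tail of a sum of independent variables with `1 < α ≤ 2`. -/
lemma exists_upper_tail_of_one_lt {α β : ℝ} (hαβ : α.HolderConjugate β) (hα2 : α ≤ 2) (D : ℝ) :
    ∃ c : ℝ, 0 < c ∧ ∀ {Ω : Type u} [MeasurableSpace Ω] {P : Measure Ω}
      [IsProbabilityMeasure P] {n : ℕ} {b : Fin n → ℝ} {Y : Fin n → Ω → ℝ} {σ B x : ℝ},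
      (∀ i, HasExpMoment α D (Y i) P) → (∀ i, ∫ ω, Y i ω ∂P = 0) → iIndepFun Y P →
      0 < σ → 0 < B → ∑ i, b i ^ 2 ≤ σ ^ 2 → ∑ i, |b i| ^ β ≤ B ^ β → 0 < x →
      P.real {ω | x ≤ ∑ i, b i * Y i ω}
        ≤ Real.exp (-(c * min ((x / σ) ^ 2) ((x / B) ^ α))) := by
  obtain ⟨M, hM, hmgf⟩ := exists_integral_exp_mul_le.{u} hαβ D
  set c := 1 / (4 * (M + 1)) with hc
  have hc0 : 0 < c := by positivity
  have hMc : M * c ≤ 1 / 4 := by rw [hc]; field_simp; linarith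
  have hc1 : c ≤ 1 := by rw [hc, div_le_one (by positivity)]; linarith
  -- This is where `α ≤ 2` enters: it gives `c ^ (β - 1) ≤ c`, so the `β`-term inherits the same
  -- small constant as the quadratic one.
  have hβ2 : 1 ≤ β - 1 := by
    have := hαβ.symm.sub_one_pos
    have h1 := hαβ.mul_eq_add
    have h2 := hαβ.sub_one_pos
    nlinarith
  refine ⟨c / 2, by positivity, ?_⟩
  intro Ω _ P _ n b Y σ B x hY h0 hind hσ hB hbσ hbB hx
  set h := min ((x / σ) ^ 2) ((x / B) ^ α) with hh
  have hh1 : h ≤ (x / σ) ^ 2 := min_le_left _ _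
  have hh2 : h ≤ (x / B) ^ α := min_le_right _ _
  have hhpos : 0 < h := lt_min (by positivity) (by positivity)
  set t := c * h / x with ht
  have ht0 : 0 < t := by positivity
  have htx : t * x = c * h := by rw [ht]; field_simp
  have hYm := fun i => (hY i).measurable
  have hZind : iIndepFun (fun i ω => b i * Y i ω) P :=
    hind.comp (fun i y => b i * y) fun i => by fun_prop
  have hm : ∀ i, Integrable (fun ω => Real.exp (t * (b i * Y i ω))) P ∧
      ∫ ω, Real.exp (t * (b i * Y i ω)) ∂P
        ≤ Real.exp (M * ((t * b i) ^ 2 + |t * b i| ^ β)) := fun i => by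
    simpa only [mul_assoc] using hmgf (hY i) (h0 i) (t * b i)
  refine (measureReal_le_sum_le_exp hZind (by fun_prop) ht0.le (fun i => (hm i).1)
    (fun i => (hm i).2) x).trans (Real.exp_le_exp.2 ?_)
  have h1 : t * σ ^ 2 ≤ c * x := by
    have : h * σ ^ 2 ≤ x ^ 2 := by
      calc h * σ ^ 2 ≤ (x / σ) ^ 2 * σ ^ 2 := by gcongr
        _ = x ^ 2 := by field_simp
    rw [ht, div_mul_eq_mul_div, div_le_iff₀ hx]
    nlinarith
  -- From `h ≤ (x / B) ^ α` and the conjugacy relation `(α - 1) (β - 1) = 1`.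
  have h2 : (t * B) ^ (β - 1) ≤ c * (x / B) := by
    have h3 : t * B ≤ c * (x / B) ^ (α - 1) := by
      calc t * B = c * h / (x / B) := by rw [ht]; field_simp
        _ ≤ c * (x / B) ^ α / (x / B) := by gcongr
        _ = _ := by rw [Real.rpow_sub_one (by positivity), mul_div_assoc]
    calc (t * B) ^ (β - 1) ≤ (c * (x / B) ^ (α - 1)) ^ (β - 1) := by gcongr
      _ = c ^ (β - 1) * (x / B) := by
          rw [Real.mul_rpow (by positivity) (by positivity), ← Real.rpow_mul (by positivity),
            show (α - 1) * (β - 1) = 1 by linarith [hαβ.mul_eq_add], Real.rpow_one]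
      _ ≤ c ^ (1 : ℝ) * (x / B) := by
          gcongr ?_ * _
          exact Real.rpow_le_rpow_of_exponent_ge hc0 hc1 hβ2
      _ = _ := by rw [Real.rpow_one]
  have h4 : (t * B) ^ β ≤ c * (t * x) := by
    calc (t * B) ^ β = (t * B) ^ (β - 1) * (t * B) := by
          rw [← Real.rpow_add_one (by positivity), sub_add_cancel]
      _ ≤ c * (x / B) * (t * B) := by gcongr
      _ = _ := by field_simp
  have hsum : ∑ i, M * ((t * b i) ^ 2 + |t * b i| ^ β) ≤ c * h / 2 := by
    calc ∑ i, M * ((t * b i) ^ 2 + |t * b i| ^ β)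
        = M * (t ^ 2 * ∑ i, b i ^ 2 + t ^ β * ∑ i, |b i| ^ β) := by
          rw [Finset.mul_sum, Finset.mul_sum, ← Finset.sum_add_distrib, Finset.mul_sum]
          refine Finset.sum_congr rfl fun i _ => ?_
          rw [mul_pow, abs_mul, abs_of_pos ht0, Real.mul_rpow ht0.le (abs_nonneg _)]
      _ ≤ M * (t ^ 2 * σ ^ 2 + t ^ β * B ^ β) := by gcongr
      _ = M * (t * (t * σ ^ 2) + (t * B) ^ β) := by rw [Real.mul_rpow ht0.le hB.le]; ring
      _ ≤ M * (t * (c * x) + c * (t * x)) := by gcongr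
      _ = M * c * (2 * (t * x)) := by ring
      _ ≤ 1 / 4 * (2 * (t * x)) := by gcongr
      _ = _ := by rw [htx]; ring
  rw [htx]
  linarith

/-! ### The exponent of the Bernstein-Orlicz function -/

/-- The exponent of `gboFun`, so that `gboFun α L x = exp (gboExp α L x) - 1`. -/
noncomputable def gboExp (α L x : ℝ) : ℝ :=
  if L = 0 then x ^ 2 else min (x ^ 2) ((x / L) ^ α)

section

variable {α L x y : ℝ}

lemma gboFun_eq : gboFun α L x = Real.exp (gboExp α L x) - 1 := by
  unfold gboFun gboExp; split_ifs <;> rfl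

lemma gboExp_le_sq : gboExp α L x ≤ x ^ 2 := by
  unfold gboExp; split_ifs
  · exact le_rfl
  · exact min_le_left _ _

lemma gboExp_nonneg (hL : 0 ≤ L) (hx : 0 ≤ x) : 0 ≤ gboExp α L x := by
  unfold gboExp; split_ifs
  · positivity
  · exact le_min (by positivity) (by positivity)

lemma gboFun_nonneg (hL : 0 ≤ L) (hx : 0 ≤ x) : 0 ≤ gboFun α L x := by
  rw [gboFun_eq, sub_nonneg]
  exact Real.one_le_exp (gboExp_nonneg hL hx)

lemma gboExp_mono (hα : 0 < α) (hL : 0 ≤ L) (hx : 0 ≤ x) (hxy : x ≤ y) :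
    gboExp α L x ≤ gboExp α L y := by
  unfold gboExp; split_ifs <;> gcongr

lemma gboFun_mono (hα : 0 < α) (hL : 0 ≤ L) (hx : 0 ≤ x) (hxy : x ≤ y) :
    gboFun α L x ≤ gboFun α L y := by
  rw [gboFun_eq, gboFun_eq]
  gcongr
  exact gboExp_mono hα hL hx hxy

lemma gboExp_strictMono (hα : 0 < α) (hL : 0 ≤ L) (hx : 0 ≤ x) (hxy : x < y) :
    gboExp α L x < gboExp α L y := by
  unfold gboExp; split_ifs with h
  · gcongr
  · have hL : 0 < L := lt_of_le_of_ne hL (Ne.symm h)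
    have h1 : (x / L) ^ α < (y / L) ^ α := by gcongr
    have h2 : x ^ 2 < y ^ 2 := by gcongr
    exact min_lt_min h2 h1

@[fun_prop]
lemma measurable_gboExp : Measurable (gboExp α L) := by
  unfold gboExp; split_ifs <;> fun_prop

/-- Every positive level of the exponent is attained. -/
lemma exists_gboExp_eq (hα : 0 < α) (hL : 0 ≤ L) {w : ℝ} (hw : 0 < w) :
    ∃ x, 0 < x ∧ gboExp α L x = w := by
  rcases hL.eq_or_lt with h | h
  · refine ⟨√w, by positivity, ?_⟩
    rw [gboExp, if_pos h.symm, Real.sq_sqrt hw.le]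
  · have h1 : (L * w ^ (1 / α) / L) ^ α = w := by
      rw [mul_div_cancel_left₀ _ h.ne', ← Real.rpow_mul hw.le, one_div_mul_cancel hα.ne',
        Real.rpow_one]
    have h2 : √w ^ 2 = w := Real.sq_sqrt hw.le
    -- The exponent is a minimum of two increasing functions, so it reaches `w` at the larger of the
    -- two solutions.
    refine ⟨max √w (L * w ^ (1 / α)), by positivity, ?_⟩
    rw [gboExp, if_neg h.ne']
    rcases le_total √w (L * w ^ (1 / α)) with hc | hc
    · rw [max_eq_right hc, h1]
      refine min_eq_right ?_
      calc w = √w ^ 2 := h2.symm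
        _ ≤ _ := by gcongr
    · rw [max_eq_left hc, h2]
      refine min_eq_left ?_
      calc w = _ := h1.symm
        _ ≤ _ := by gcongr

/-- Scaling of the exponent, in the argument and in the parameter. -/
lemma gboExp_div_le (hα : 0 < α) (hL : 0 ≤ L) (hx : 0 ≤ x) {C : ℝ} (hC : 1 ≤ C) :
    gboExp α (C * L) (x / C) ≤ (1 / C) ^ min α 1 * gboExp α L x := by
  have hC0 : 0 < C := by linarith
  have h1C : 1 / C ≤ 1 := by rw [div_le_one hC0]; exact hC
  have h1 : (x / C) ^ 2 ≤ (1 / C) ^ min α 1 * x ^ 2 := by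
    calc (x / C) ^ 2 = (1 / C) ^ (2 : ℝ) * x ^ 2 := by rw [Real.rpow_two]; ring
      _ ≤ _ := by
        gcongr ?_ * _
        refine Real.rpow_le_rpow_of_exponent_ge (by positivity) h1C ?_
        linarith [min_le_right α 1]
  rcases hL.eq_or_lt with h | h
  · rw [← h, mul_zero, gboExp, if_pos rfl, gboExp, if_pos rfl]
    exact h1
  · rw [gboExp, gboExp, if_neg (by positivity), if_neg h.ne',
      mul_min_of_nonneg _ _ (by positivity)]
    refine min_le_min h1 ?_
    -- Argument and parameter together contribute `1 / C ^ 2`; one factor `1 / C` suffices.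
    calc (x / C / (C * L)) ^ α ≤ (1 / C * (x / L)) ^ α := by
          gcongr
          rw [div_div, div_mul_div_comm, one_mul]
          have : C * L ≤ C * (C * L) := by
            have : 0 < C * L := by positivity
            nlinarith
          gcongr
      _ = (1 / C) ^ α * (x / L) ^ α := Real.mul_rpow (by positivity) (by positivity)
      _ ≤ _ := by
        gcongr ?_ * _
        exact Real.rpow_le_rpow_of_exponent_ge (by positivity) h1C (min_le_left _ _)

end

/-! ### Orlicz norms and tails -/

lemma orliczNorm_le {Ω : Type u} [MeasurableSpace Ω] {P : Measure Ω} {g : ℝ → ℝ} {X : Ω → ℝ}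
    {η : ℝ} (hη : 0 < η) (h : ∫⁻ ω, ENNReal.ofReal (g (|X ω| / η)) ∂P ≤ 1) :
    orliczNorm g X P ≤ ENNReal.ofReal η :=
  iInf_le_of_le η (iInf_le_of_le hη (iInf_le _ h))

/-- The integral is nonincreasing in the scale, so one failing `η` excludes all smaller ones. -/
lemma le_orliczNorm {Ω : Type u} [MeasurableSpace Ω] {P : Measure Ω} {α L : ℝ} {X : Ω → ℝ}
    (hα : 0 < α) (hL : 0 ≤ L) {η : ℝ}
    (h : 1 < ∫⁻ ω, ENNReal.ofReal (gboFun α L (|X ω| / η)) ∂P) :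
    ENNReal.ofReal η ≤ orliczNorm (gboFun α L) X P := by
  refine le_iInf fun η' => le_iInf fun hη' => le_iInf fun h' => ?_
  by_contra! hlt
  have hlt' : η' < η := (ENNReal.ofReal_lt_ofReal_iff_of_nonneg hη'.le).1 hlt
  refine absurd (h.trans_le (le_trans ?_ h')) (lt_irrefl _)
  gcongr with ω
  have : 0 < η := hη'.trans hlt'
  exact gboFun_mono hα hL (by positivity) (by gcongr)

lemma IsSubWeibull.integral_exp_gboExp_le {Ω : Type u} [MeasurableSpace Ω] {P : Measure Ω}
    [IsProbabilityMeasure P] {α L : ℝ} {X : Ω → ℝ} (hα : 0 < α) (hL : 0 ≤ L)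
    (h : IsSubWeibull α L 1 X P) :
    Integrable (fun ω => Real.exp (gboExp α L (|X ω| / 2))) P ∧
      ∫ ω, Real.exp (gboExp α L (|X ω| / 2)) ∂P ≤ 2 := by
  have hm := h.measurable
  -- Doubling the scale avoids having to show that the infimum is attained: some admissible `η` lies
  -- below `2`.
  have h2 : orliczNorm (gboFun α L) X P < ENNReal.ofReal 2 :=
    h.norm_le.trans_lt ((ENNReal.ofReal_lt_ofReal_iff (by norm_num)).2 (by norm_num))
  simp only [orliczNorm, iInf_lt_iff] at h2
  obtain ⟨η, hη, hle, hη2⟩ := h2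
  replace hη2 : η < 2 := (ENNReal.ofReal_lt_ofReal_iff (by norm_num)).1 hη2
  have hlt : ∫⁻ ω, ENNReal.ofReal (Real.exp (gboExp α L (|X ω| / 2))) ∂P ≤ ENNReal.ofReal 2 := by
    calc ∫⁻ ω, ENNReal.ofReal (Real.exp (gboExp α L (|X ω| / 2))) ∂P
        ≤ ∫⁻ ω, (ENNReal.ofReal (gboFun α L (|X ω| / η)) + 1) ∂P := by
          refine lintegral_mono fun ω => ?_
          rw [← ENNReal.ofReal_one, ← ENNReal.ofReal_add
            (gboFun_nonneg hL (by positivity)) zero_le_one, gboFun_eq, sub_add_cancel]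
          gcongr
          exact gboExp_mono hα hL (by positivity) (by gcongr)
      _ = ∫⁻ ω, ENNReal.ofReal (gboFun α L (|X ω| / η)) ∂P + 1 := by
          rw [lintegral_add_right _ measurable_const]; simp
      _ ≤ 1 + 1 := by gcongr
      _ = ENNReal.ofReal 2 := by norm_num
  have hmm : Measurable fun ω => Real.exp (gboExp α L (|X ω| / 2)) := by fun_prop
  have hint := (lintegral_ofReal_ne_top_iff_integrable hmm.aestronglyMeasurable
    (Filter.Eventually.of_forall fun ω => (Real.exp_pos _).le)).1
      (hlt.trans_lt ENNReal.ofReal_lt_top).ne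
  refine ⟨hint, ?_⟩
  rw [← ofReal_integral_eq_lintegral_ofReal hint
    (Filter.Eventually.of_forall fun ω => (Real.exp_pos _).le)] at hlt
  exact (ENNReal.ofReal_le_ofReal_iff (by norm_num)).1 hlt

/-- An exponential tail gives a bounded exponential moment. -/
lemma exists_lintegral_exp_le (K : ℝ) {c : ℝ} (hc : 0 < c) :
    ∃ D : ℝ, 0 < D ∧ ∀ {Ω : Type u} [MeasurableSpace Ω] {P : Measure Ω} [IsProbabilityMeasure P]
      {W : Ω → ℝ}, Measurable W → (∀ ω, 0 ≤ W ω) →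
      (∀ w, 0 < w → P.real {ω | w ≤ W ω} ≤ K * Real.exp (-(c * w))) →
      ∫⁻ ω, ENNReal.ofReal (Real.exp (c / 2 * W ω)) ∂P ≤ ENNReal.ofReal D := by
  -- The tail is assumed only for `w > 0`; the value `1` covers the slice `k = 0` below.
  set K' := max K 1 with hK'
  have hK'0 : 0 < K' := by positivity
  have hs : Summable fun k : ℕ => K' * Real.exp (c / 2) * Real.exp (-(c / 2)) ^ k :=
    (summable_geometric_of_lt_one (by positivity)
      (Real.exp_lt_one_iff.2 (by linarith))).mul_left _
  refine ⟨∑' k : ℕ, K' * Real.exp (c / 2) * Real.exp (-(c / 2)) ^ k,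
    hs.tsum_pos (fun k => by positivity) 0 (by positivity), fun {Ω} _ P _ W hW hW0 htail => ?_⟩
  have hset : ∀ k : ℕ, MeasurableSet {ω | (k : ℝ) ≤ W ω} := fun k =>
    measurableSet_le measurable_const hW
  calc ∫⁻ ω, ENNReal.ofReal (Real.exp (c / 2 * W ω)) ∂P
      ≤ ∫⁻ ω, ∑' k : ℕ, {ω | (k : ℝ) ≤ W ω}.indicator
          (fun _ => ENNReal.ofReal (Real.exp (c / 2 * (k + 1)))) ω ∂P := by
        refine lintegral_mono fun ω => ?_
        refine le_trans ?_ (ENNReal.le_tsum ⌊W ω⌋₊)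
        have hmem : ω ∈ {ω' | ((⌊W ω⌋₊ : ℕ) : ℝ) ≤ W ω'} := Nat.floor_le (hW0 ω)
        rw [Set.indicator_of_mem hmem]
        gcongr
        exact (Nat.lt_floor_add_one _).le
    _ = ∑' k : ℕ, ENNReal.ofReal (Real.exp (c / 2 * (k + 1))) * P {ω | (k : ℝ) ≤ W ω} := by
        rw [lintegral_tsum fun k => (measurable_const.indicator (hset k)).aemeasurable]
        exact tsum_congr fun k => lintegral_indicator_const (hset k) _
    _ ≤ ∑' k : ℕ, ENNReal.ofReal (K' * Real.exp (c / 2) * Real.exp (-(c / 2)) ^ k) := by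
        refine ENNReal.tsum_le_tsum fun k => ?_
        have hk : P.real {ω | (k : ℝ) ≤ W ω} ≤ K' * Real.exp (-(c * k)) := by
          rcases Nat.eq_zero_or_pos k with rfl | hk
          · rw [Nat.cast_zero, mul_zero, neg_zero, Real.exp_zero, mul_one]
            exact measureReal_le_one.trans (le_max_right K 1)
          · refine (htail k (by positivity)).trans ?_
            gcongr
            exact le_max_left _ _
        rw [← ofReal_measureReal, ← ENNReal.ofReal_mul (by positivity)]
        refine ENNReal.ofReal_le_ofReal ?_
        calc _ ≤ Real.exp (c / 2 * (k + 1)) * (K' * Real.exp (-(c * k))) := by gcongr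
          _ = K' * (Real.exp (c / 2 * (k + 1)) * Real.exp (-(c * k))) := by ring
          _ = _ := by
            rw [← Real.exp_nat_mul, mul_assoc, ← Real.exp_add, ← Real.exp_add]
            congr 2; ring
    _ = _ := (ENNReal.ofReal_tsum_of_nonneg (fun k => by positivity) hs).symm

/-- A tail bound in terms of `gboExp` bounds the Orlicz norm. -/
lemma exists_orliczNorm_le {α : ℝ} (hα : 0 < α) (K : ℝ) {c : ℝ} (hc : 0 < c) :
    ∃ C₀ : ℝ, 0 < C₀ ∧ ∀ C, C₀ ≤ C → ∀ {Ω : Type u} [MeasurableSpace Ω] {P : Measure Ω}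
      [IsProbabilityMeasure P] {S : Ω → ℝ} {r σ : ℝ}, Measurable S → 0 ≤ r → 0 < σ →
      (∀ x, 0 < x → P.real {ω | x ≤ |S ω|} ≤ K * Real.exp (-(c * gboExp α r (x / σ)))) →
      orliczNorm (gboFun α (C * r)) S P ≤ ENNReal.ofReal (C * σ) := by
  obtain ⟨D, hD, hexp⟩ := exists_lintegral_exp_le.{u} K hc
  have hδ : 0 < min α 1 := by positivity
  have hlim : Filter.Tendsto (fun C : ℝ => 2 / c * (1 / C) ^ min α 1) Filter.atTop (nhds 0) := by
    have h := (tendsto_rpow_neg_atTop hδ).const_mul (2 / c)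
    rw [mul_zero] at h
    refine h.congr' ?_
    filter_upwards [Filter.eventually_gt_atTop 0] with C hC
    rw [one_div, Real.inv_rpow hC.le, Real.rpow_neg hC.le]
  -- The factor `ε` gained by rescaling must be at most `1` for convexity, and at most `1 / D` to
  -- bring the integral below `1`.
  obtain ⟨C₁, hC₁⟩ := Filter.eventually_atTop.1
    (hlim.eventually (ge_mem_nhds (show (0 : ℝ) < min 1 (1 / D) by positivity)))
  refine ⟨max C₁ 1, by positivity, ?_⟩
  intro C hC Ω _ P _ S r σ hS hr hσ htail
  have hC1 : 1 ≤ C := (le_max_right _ _).trans hC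
  have hC0 : 0 < C := by linarith
  set ε := 2 / c * (1 / C) ^ min α 1 with hε
  have hεle := hC₁ C ((le_max_left _ _).trans hC)
  have hε0 : 0 ≤ ε := by positivity
  have hε1 : ε ≤ 1 := hεle.trans (min_le_left _ _)
  have hεD : ε * D ≤ 1 := by
    have := hεle.trans (min_le_right _ _)
    rwa [le_div_iff₀ hD] at this
  refine orliczNorm_le (by positivity) ?_
  have hW := hexp (P := P) (W := fun ω => gboExp α r (|S ω| / σ)) (by fun_prop)
    (fun ω => gboExp_nonneg hr (by positivity)) fun w hw => by
      obtain ⟨x, hx, hxw⟩ := exists_gboExp_eq hα hr hw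
      have h := htail (x * σ) (by positivity)
      rw [mul_div_cancel_right₀ _ hσ.ne', hxw] at h
      refine le_trans (measureReal_mono fun ω hω => ?_) h
      simp only [Set.mem_ofPred_eq, ← hxw] at hω ⊢
      rw [← le_div_iff₀ hσ]
      by_contra! hlt
      exact absurd (gboExp_strictMono hα hr (by positivity) hlt) (not_lt.2 hω)
  calc ∫⁻ ω, ENNReal.ofReal (gboFun α (C * r) (|S ω| / (C * σ))) ∂P
      ≤ ∫⁻ ω, ENNReal.ofReal ε *
          ENNReal.ofReal (Real.exp (c / 2 * gboExp α r (|S ω| / σ))) ∂P := by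
        refine lintegral_mono fun ω => ?_
        rw [← ENNReal.ofReal_mul hε0]
        refine ENNReal.ofReal_le_ofReal ?_
        rw [gboFun_eq, mul_comm C σ, ← div_div]
        calc _ ≤ Real.exp (ε * (c / 2 * gboExp α r (|S ω| / σ))) - 1 := by
              gcongr
              refine (gboExp_div_le hα hr (by positivity) hC1).trans_eq ?_
              rw [hε]; field_simp
          _ ≤ ε * (Real.exp (c / 2 * gboExp α r (|S ω| / σ)) - 1) := exp_mul_sub_one_le hε0 hε1
          _ ≤ _ := by gcongr; linarith
    _ = ENNReal.ofReal ε * ∫⁻ ω, ENNReal.ofReal (Real.exp (c / 2 * gboExp α r (|S ω| / σ))) ∂P :=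
        lintegral_const_mul _ (by fun_prop)
    _ ≤ ENNReal.ofReal ε * ENNReal.ofReal D := by gcongr
    _ ≤ 1 := by
        rw [← ENNReal.ofReal_mul hε0]
        exact ENNReal.ofReal_le_one.2 hεD

/-! ### Vector norms -/

section

variable {n : ℕ} {α : ℝ}

lemma vecNorm_two_sq (v : Fin n → ℝ) : vecNorm 2 v ^ 2 = ∑ i, v i ^ 2 := by
  unfold vecNorm
  rw [EuclideanSpace.norm_sq_eq]
  simp

lemma vecNorm_two_nonneg (v : Fin n → ℝ) : 0 ≤ vecNorm 2 v := norm_nonneg _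

lemma vecNorm_betaExp_of_le_one (hα : α ≤ 1) (v : Fin n → ℝ) :
    vecNorm (betaExp α) v = ⨆ i, |v i| := by
  rw [betaExp, if_pos hα, vecNorm, PiLp.norm_eq_ciSup]
  rfl

lemma vecNorm_betaExp_of_one_lt {β : ℝ} (hαβ : α.HolderConjugate β) (v : Fin n → ℝ) :
    vecNorm (betaExp α) v = (∑ i, |v i| ^ β) ^ (1 / β) := by
  have hβ : α / (α - 1) = β := hαβ.conjugate_eq.symm
  have h : (ENNReal.ofReal β).toReal = β := ENNReal.toReal_ofReal hαβ.symm.nonneg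
  rw [betaExp, if_neg (not_le.2 hαβ.lt), vecNorm, hβ,
    PiLp.norm_eq_sum (by rw [h]; exact hαβ.symm.pos), h]
  rfl

lemma vecNorm_betaExp_nonneg (v : Fin n → ℝ) : 0 ≤ vecNorm (betaExp α) v := by
  rcases le_or_gt α 1 with h | h
  · rw [vecNorm_betaExp_of_le_one h]
    exact Real.iSup_nonneg fun i => abs_nonneg _
  · rw [vecNorm_betaExp_of_one_lt (Real.HolderConjugate.conjExponent h)]
    positivity

lemma sum_abs_rpow_eq {β : ℝ} (hαβ : α.HolderConjugate β) (v : Fin n → ℝ) :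
    ∑ i, |v i| ^ β = vecNorm (betaExp α) v ^ β := by
  rw [vecNorm_betaExp_of_one_lt hαβ, ← Real.rpow_mul (by positivity),
    one_div_mul_cancel hαβ.symm.ne_zero, Real.rpow_one]

lemma abs_le_vecNorm_betaExp (v : Fin n → ℝ) (i : Fin n) : |v i| ≤ vecNorm (betaExp α) v := by
  rcases le_or_gt α 1 with h | h
  · rw [vecNorm_betaExp_of_le_one h]
    exact le_ciSup (f := fun i => |v i|) (Set.finite_range _).bddAbove i
  · have hαβ := Real.HolderConjugate.conjExponent h
    refine (Real.rpow_le_rpow_iff (abs_nonneg _) (vecNorm_betaExp_nonneg v) hαβ.symm.pos).1 ?_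
    rw [← sum_abs_rpow_eq hαβ]
    exact Finset.single_le_sum (f := fun i => |v i| ^ α.conjExponent)
      (fun j _ => by positivity) (Finset.mem_univ i)

/-- The dual description of `‖·‖_β`. -/
lemma exists_sum_mul_eq_vecNorm_betaExp (hα : 0 < α) {v : Fin n → ℝ}
    (hv : 0 < vecNorm (betaExp α) v) :
    ∃ w : Fin n → ℝ, (∀ i, 0 ≤ w i) ∧ ∑ i, |v i| * w i = vecNorm (betaExp α) v ∧
      ∑ i, w i ^ α ≤ 1 := by
  rcases le_or_gt α 1 with h | h
  · rw [vecNorm_betaExp_of_le_one h] at hv ⊢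
    have hne : Nonempty (Fin n) := by
      by_contra hemp
      rw [not_nonempty_iff] at hemp
      simp at hv
    obtain ⟨j, hj⟩ := exists_eq_ciSup_of_finite (f := fun i => |v i|)
    refine ⟨fun i => if i = j then 1 else 0, fun i => by dsimp only; split_ifs <;> norm_num, ?_, ?_⟩
    · rw [← hj]; simp
    · refine le_of_eq ?_
      rw [Finset.sum_eq_single j]
      · simp
      · intro i _ hij; simp [hij, hα.ne']
      · simp
  · have hαβ := Real.HolderConjugate.conjExponent h
    set β := α.conjExponent with hβ
    set B := vecNorm (betaExp α) v with hB
    have hBβ : 0 < B ^ β := by positivity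
    have hsum := sum_abs_rpow_eq hαβ v
    -- The equality case of Hölder's inequality; `(β - 1) α = β` normalises it in `ℓ_α`.
    refine ⟨fun i => (|v i| / B) ^ (β - 1), fun i => by positivity, ?_, ?_⟩
    · have h1 : ∀ i, |v i| * (|v i| / B) ^ (β - 1) = |v i| ^ β / B ^ (β - 1) := fun i => by
        rcases (abs_nonneg (v i)).eq_or_lt with h0 | h0
        · rw [← h0, zero_mul, Real.zero_rpow hαβ.symm.ne_zero, zero_div]
        · rw [Real.div_rpow h0.le hv.le, ← mul_div_assoc, mul_comm,
            ← Real.rpow_add_one h0.ne', sub_add_cancel]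
      simp only [h1]
      rw [← Finset.sum_div, hsum, ← hB, ← Real.rpow_sub hv, sub_sub_cancel, Real.rpow_one]
    · have h1 : ∀ i, ((|v i| / B) ^ (β - 1)) ^ α = |v i| ^ β / B ^ β := fun i => by
        rw [← Real.rpow_mul (by positivity),
          show (β - 1) * α = β by linarith [hαβ.mul_eq_add], Real.div_rpow (by positivity) hv.le]
      simp only [h1]
      rw [← Finset.sum_div, hsum, ← hB, div_self hBβ.ne']

end

/-! ### Two-sided tails -/

section

variable {Ω : Type u} [MeasurableSpace Ω] {P : Measure Ω} [IsProbabilityMeasure P]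

lemma measureReal_le_abs_le {n : ℕ} {b : Fin n → ℝ} {Y : Fin n → Ω → ℝ} {x q : ℝ}
    (h1 : P.real {ω | x ≤ ∑ i, b i * Y i ω} ≤ q)
    (h2 : P.real {ω | x ≤ ∑ i, b i * -Y i ω} ≤ q) :
    P.real {ω | x ≤ |∑ i, b i * Y i ω|} ≤ 2 * q := by
  have hsub : {ω | x ≤ |∑ i, b i * Y i ω|}
      ⊆ {ω | x ≤ ∑ i, b i * Y i ω} ∪ {ω | x ≤ ∑ i, b i * -Y i ω} := fun ω hω => by
    simpa only [Set.mem_union, Set.mem_ofPred_eq, mul_neg, Finset.sum_neg_distrib, le_abs]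
      using hω
  calc _ ≤ _ := measureReal_mono hsub
    _ ≤ _ := measureReal_union_le _ _
    _ ≤ 2 * q := by linarith

end

lemma exists_tail_of_le_two {α : ℝ} (hα : 0 < α) (hα2 : α ≤ 2) (D : ℝ) :
    ∃ K c : ℝ, 0 < K ∧ 0 < c ∧ ∀ {Ω : Type u} [MeasurableSpace Ω] {P : Measure Ω}
      [IsProbabilityMeasure P] {n : ℕ} {b : Fin n → ℝ} {Y : Fin n → Ω → ℝ} {σ x : ℝ},
      (∀ i, HasExpMoment α D (Y i) P) → (∀ i, ∫ ω, Y i ω ∂P = 0) → iIndepFun Y P →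
      0 < σ → 0 < vecNorm (betaExp α) b → ∑ i, b i ^ 2 ≤ σ ^ 2 → 0 < x →
      P.real {ω | x ≤ |∑ i, b i * Y i ω|}
        ≤ K * Real.exp (-(c * min ((x / σ) ^ 2) ((x / vecNorm (betaExp α) b) ^ α))) := by
  have hneg : ∀ {Ω : Type u} [MeasurableSpace Ω] {P : Measure Ω} {n : ℕ} {Y : Fin n → Ω → ℝ},
      iIndepFun Y P → iIndepFun (fun i ω => -Y i ω) P := fun h =>
    h.comp (fun _ y => -y) fun _ => measurable_neg
  rcases le_or_gt α 1 with h | h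
  · obtain ⟨K, c, hK, hc, H⟩ := exists_upper_tail_of_le_one.{u} hα h D
    refine ⟨2 * K, c, by positivity, hc, ?_⟩
    intro Ω _ P _ n b Y σ x hY h0 hind hσ hB hb hx
    rw [mul_assoc]
    exact measureReal_le_abs_le
      (H hY h0 hind hσ hB hb (abs_le_vecNorm_betaExp b) hx)
      (H (fun i => (hY i).neg) (fun i => by rw [integral_neg, h0, neg_zero]) (hneg hind) hσ hB hb
        (abs_le_vecNorm_betaExp b) hx)
  · have hαβ := Real.HolderConjugate.conjExponent h
    obtain ⟨c, hc, H⟩ := exists_upper_tail_of_one_lt.{u} hαβ hα2 D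
    refine ⟨2, c, by positivity, hc, ?_⟩
    intro Ω _ P _ n b Y σ x hY h0 hind hσ hB hb hx
    exact measureReal_le_abs_le
      (H hY h0 hind hσ hB hb (sum_abs_rpow_eq hαβ b).le hx)
      (H (fun i => (hY i).neg) (fun i => by rw [integral_neg, h0, neg_zero]) (hneg hind) hσ hB hb
        (sum_abs_rpow_eq hαβ b).le hx)

lemma exists_subgaussian_tail (D : ℝ) :
    ∃ c : ℝ, 0 < c ∧ ∀ {Ω : Type u} [MeasurableSpace Ω] {P : Measure Ω}
      [IsProbabilityMeasure P] {n : ℕ} {b : Fin n → ℝ} {Y : Fin n → Ω → ℝ} {σ x : ℝ},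
      (∀ i, HasExpMoment 2 D (Y i) P) → (∀ i, ∫ ω, Y i ω ∂P = 0) → iIndepFun Y P →
      0 < σ → ∑ i, b i ^ 2 ≤ σ ^ 2 → 0 < x →
      P.real {ω | x ≤ |∑ i, b i * Y i ω|} ≤ 2 * Real.exp (-(c * (x / σ) ^ 2)) := by
  obtain ⟨c, hc, H⟩ := exists_upper_tail_of_one_lt.{u} Real.HolderConjugate.two_two le_rfl D
  refine ⟨c, hc, ?_⟩
  intro Ω _ P _ n b Y σ x hY h0 hind hσ hb hx
  have hb' : ∑ i, |b i| ^ (2 : ℝ) ≤ σ ^ (2 : ℝ) := by simpa [Real.rpow_two] using hb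
  have h := measureReal_le_abs_le
    (H hY h0 hind hσ hσ hb hb' hx)
    (H (fun i => (hY i).neg) (fun i => by rw [integral_neg, h0, neg_zero])
      (hind.comp (fun _ y => -y) fun _ => measurable_neg) hσ hσ hb hb' hx)
  rwa [Real.rpow_two, min_self] at h

/-! ### Splitting into a sub-Gaussian and a sub-Weibull part -/

open Classical in
/-- The part of `x / 2` on which the exponent of `gboFun α L` is quadratic. -/
noncomputable def gaussPart (α L x : ℝ) : ℝ :=
  if L = 0 ∨ (x / 2) ^ 2 ≤ (|x| / 2 / L) ^ α then x / 2 else 0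

open Classical in
/-- The part of `x / 2 / L` on which the exponent of `gboFun α L` is `(x / L) ^ α`. -/
noncomputable def weibullPart (α L x : ℝ) : ℝ :=
  if L = 0 ∨ (x / 2) ^ 2 ≤ (|x| / 2 / L) ^ α then 0 else x / 2 / L

section

variable {α L : ℝ}

lemma gaussPart_add_weibullPart (x : ℝ) :
    x = 2 * (gaussPart α L x + L * weibullPart α L x) := by
  unfold gaussPart weibullPart
  split_ifs with h
  · ring
  · have : L ≠ 0 := fun h0 => h (Or.inl h0)
    field_simp
    ring

lemma measurableSet_gaussPart : MeasurableSet {x : ℝ | L = 0 ∨ (x / 2) ^ 2 ≤ (|x| / 2 / L) ^ α} :=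
  (MeasurableSet.const _).union (measurableSet_le
    (by fun_prop : Measurable fun x : ℝ => (x / 2) ^ 2)
    (by fun_prop : Measurable fun x : ℝ => (|x| / 2 / L) ^ α))

lemma measurable_gaussPart : Measurable (gaussPart α L) :=
  Measurable.ite measurableSet_gaussPart (by fun_prop) measurable_const

lemma measurable_weibullPart : Measurable (weibullPart α L) :=
  Measurable.ite measurableSet_gaussPart measurable_const (by fun_prop)

lemma abs_gaussPart_rpow_le (hL : 0 ≤ L) (x : ℝ) :
    |gaussPart α L x| ^ (2 : ℝ) ≤ gboExp α L (|x| / 2) := by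
  rw [Real.rpow_two, sq_abs]
  unfold gaussPart
  split_ifs with h
  · have hsq : (x / 2) ^ 2 = (|x| / 2) ^ 2 := by rw [div_pow, div_pow, sq_abs]
    unfold gboExp
    split_ifs with h0
    · exact hsq.le
    · exact le_min hsq.le (h.resolve_left h0)
  · rw [zero_pow two_ne_zero]
    exact gboExp_nonneg hL (by positivity)

lemma abs_weibullPart_rpow_le (hα : 0 < α) (hL : 0 ≤ L) (x : ℝ) :
    |weibullPart α L x| ^ α ≤ gboExp α L (|x| / 2) := by
  unfold weibullPart
  split_ifs with h
  · rw [abs_zero, Real.zero_rpow hα.ne']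
    exact gboExp_nonneg hL (by positivity)
  · push Not at h
    have hsq : (x / 2) ^ 2 = (|x| / 2) ^ 2 := by rw [div_pow, div_pow, sq_abs]
    rw [gboExp, if_neg h.1, abs_div, abs_div, abs_two, abs_of_nonneg hL]
    exact le_min (hsq ▸ h.2.le) le_rfl

end

/-! ### Tails of sums over `SubWeibullTuple` -/

section

variable {n : ℕ} (a L : Fin n → ℝ)

lemma weightedTwoNorm_sq : weightedTwoNorm a L ^ 2 = ∑ i, (a i * max 1 (L i)) ^ 2 :=
  vecNorm_two_sq _

lemma sum_sq_le_weightedTwoNorm_sq : ∑ i, a i ^ 2 ≤ weightedTwoNorm a L ^ 2 := by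
  rw [weightedTwoNorm_sq]
  refine Finset.sum_le_sum fun i _ => ?_
  rw [mul_pow]
  exact le_mul_of_one_le_right (sq_nonneg _) (one_le_pow₀ (le_max_left _ _))

lemma sum_mul_sq_le_weightedTwoNorm_sq (hL : ∀ i, 0 ≤ L i) :
    ∑ i, (a i * L i) ^ 2 ≤ weightedTwoNorm a L ^ 2 := by
  rw [weightedTwoNorm_sq]
  refine Finset.sum_le_sum fun i _ => ?_
  rw [mul_pow, mul_pow]
  have := hL i
  gcongr
  exact le_max_right _ _

end

lemma exists_subWeibullTuple_tail_of_le_two {α : ℝ} (hα : 0 < α) (hα2 : α ≤ 2) :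
    ∃ K c : ℝ, 0 < c ∧ ∀ {Ω : Type u} [MeasurableSpace Ω] {P : Measure Ω}
      [IsProbabilityMeasure P] {n : ℕ} {a L : Fin n → ℝ} {X : Fin n → Ω → ℝ},
      (∀ i, 0 ≤ L i) → SubWeibullTuple α L X P → 0 < weightedTwoNorm a L → ∀ x, 0 < x →
      P.real {ω | x ≤ |∑ i, a i * X i ω|} ≤ K * Real.exp (-(c *
        gboExp α (weightedBetaNorm α a L / weightedTwoNorm a L) (x / weightedTwoNorm a L))) := by
  obtain ⟨D₁, hD₁⟩ := exists_hasExpMoment_center.{u} two_pos 2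
  obtain ⟨D₂, hD₂⟩ := exists_hasExpMoment_center.{u} hα 2
  obtain ⟨c₁, hc₁, H₁⟩ := exists_subgaussian_tail.{u} D₁
  obtain ⟨K₂, c₂, hK₂, hc₂, H₂⟩ := exists_tail_of_le_two.{u} hα hα2 D₂
  obtain ⟨M₁, -, hM₁⟩ := exists_integral_expWeight_le.{u} two_pos 2
  obtain ⟨M₂, -, hM₂⟩ := exists_integral_expWeight_le.{u} hα 2
  -- The splitting reads `S = 4 (∑ a_i U'_i + ∑ a_i L_i V'_i)`, so one of the two sums reaches `x /
  -- 8`; `64` bounds both `8 ^ 2` and `8 ^ α`.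
  refine ⟨2 + K₂, min c₁ c₂ / 64, by positivity, ?_⟩
  intro Ω _ P _ n a L X hL hX hσ x hx
  set σ := weightedTwoNorm a L with hσdef
  set B := weightedBetaNorm α a L with hBdef
  have hB0 : 0 ≤ B := vecNorm_betaExp_nonneg _
  set U : Fin n → Ω → ℝ := fun i ω => gaussPart α (L i) (X i ω) with hU
  set V : Fin n → Ω → ℝ := fun i ω => weibullPart α (L i) (X i ω) with hV
  have hXm := fun i => (hX.mem i).measurable
  have hUexp : ∀ i, HasExpMoment 2 2 (U i) P := fun i =>
    have h := (hX.mem i).integral_exp_gboExp_le hα (hL i)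
    HasExpMoment.of_le (measurable_gaussPart.comp (hXm i)) h.1 h.2 fun ω =>
      Real.exp_le_exp.2 (abs_gaussPart_rpow_le (hL i) _)
  have hVexp : ∀ i, HasExpMoment α 2 (V i) P := fun i =>
    have h := (hX.mem i).integral_exp_gboExp_le hα (hL i)
    HasExpMoment.of_le (measurable_weibullPart.comp (hXm i)) h.1 h.2 fun ω =>
      Real.exp_le_exp.2 (abs_weibullPart_rpow_le hα (hL i) _)
  have hUi := fun i => (hM₁ (hUexp i)).2.2.1
  have hVi := fun i => (hM₂ (hVexp i)).2.2.1
  set U' : Fin n → Ω → ℝ := fun i ω => (U i ω - ∫ ω, U i ω ∂P) / 2 with hU'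
  set V' : Fin n → Ω → ℝ := fun i ω => (V i ω - ∫ ω, V i ω ∂P) / 2 with hV'
  have hcenter : ∀ {Z : Ω → ℝ}, Integrable Z P → ∫ ω, (Z ω - ∫ ω, Z ω ∂P) / 2 ∂P = 0 := fun hZ => by
    rw [integral_div, integral_sub hZ (integrable_const _)]
    simp
  have hU'ind : iIndepFun U' P :=
    hX.indep.comp (fun i y => (gaussPart α (L i) y - ∫ ω, U i ω ∂P) / 2) fun i =>
      (measurable_gaussPart.sub_const _).div_const _
  have hV'ind : iIndepFun V' P :=
    hX.indep.comp (fun i y => (weibullPart α (L i) y - ∫ ω, V i ω ∂P) / 2) fun i =>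
      (measurable_weibullPart.sub_const _).div_const _
  -- The parts need not be centered individually, but their means cancel, so centering both leaves
  -- the total sum unchanged.
  have hmean : ∀ i, ∫ ω, U i ω ∂P + L i * ∫ ω, V i ω ∂P = 0 := fun i => by
    have h := (hX.mem i).mean_zero
    have h2 : ∀ ω, X i ω = 2 * (U i ω + L i * V i ω) := fun ω => gaussPart_add_weibullPart _
    simp only [h2] at h
    rw [integral_const_mul, integral_add (hUi i) ((hVi i).const_mul _), integral_const_mul] at h
    linarith
  have hsplit : ∀ ω, ∑ i, a i * X i ω
      = 4 * (∑ i, a i * U' i ω + ∑ i, a i * L i * V' i ω) := fun ω => by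
    rw [← Finset.sum_add_distrib, Finset.mul_sum]
    refine Finset.sum_congr rfl fun i _ => ?_
    have h2 : X i ω = 2 * (U i ω + L i * V i ω) := gaussPart_add_weibullPart _
    rw [h2]
    simp only [hU', hV']
    linear_combination (2 * a i) * hmean i
  have hsub : {ω | x ≤ |∑ i, a i * X i ω|}
      ⊆ {ω | x / 8 ≤ |∑ i, a i * U' i ω|} ∪ {ω | x / 8 ≤ |∑ i, a i * L i * V' i ω|} :=
    fun ω hω => by
      simp only [Set.mem_union, Set.mem_ofPred_eq] at hω ⊢
      rw [hsplit, abs_mul, abs_of_pos (by norm_num : (0 : ℝ) < 4)] at hω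
      by_contra! hcon
      have := abs_add_le (∑ i, a i * U' i ω) (∑ i, a i * L i * V' i ω)
      linarith
  set h := gboExp α (B / σ) (x / σ) with hh
  have hh0 : 0 ≤ h := gboExp_nonneg (by positivity) (by positivity)
  have hmono : ∀ {c y : ℝ}, min c₁ c₂ ≤ c → h / 64 ≤ y →
      Real.exp (-(c * y)) ≤ Real.exp (-(min c₁ c₂ / 64 * h)) := fun {c y} hc hy => by
    refine Real.exp_le_exp.2 (neg_le_neg ?_)
    have h0 : 0 ≤ min c₁ c₂ := by positivity
    calc min c₁ c₂ / 64 * h = min c₁ c₂ * (h / 64) := by ring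
      _ ≤ c * y := by gcongr; exact h0.trans hc
  have hbound₁ : P.real {ω | x / 8 ≤ |∑ i, a i * U' i ω|}
      ≤ 2 * Real.exp (-(min c₁ c₂ / 64 * h)) := by
    refine (H₁ (fun i => hD₁ (hUexp i)) (fun i => hcenter (hUi i)) hU'ind hσ
      (sum_sq_le_weightedTwoNorm_sq a L) (by positivity)).trans ?_
    gcongr 2 * ?_
    refine hmono (min_le_left _ _) ?_
    calc h / 64 ≤ (x / σ) ^ 2 / 64 := by gcongr; exact gboExp_le_sq
      _ = _ := by ring
  have hbound₂ : P.real {ω | x / 8 ≤ |∑ i, a i * L i * V' i ω|}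
      ≤ K₂ * Real.exp (-(min c₁ c₂ / 64 * h)) := by
    rcases hB0.eq_or_lt with hB | hB
    · have hz : ∀ i, a i * L i = 0 := fun i => by
        have := abs_le_vecNorm_betaExp (α := α) (fun i => a i * L i) i
        rw [hBdef, weightedBetaNorm] at hB
        rw [← hB] at this
        exact abs_nonpos_iff.1 this
      have hemp : {ω | x / 8 ≤ |∑ i, a i * L i * V' i ω|} = ∅ := by
        ext ω
        simp only [hz, zero_mul, Finset.sum_const_zero, abs_zero, Set.mem_ofPred_eq,
          Set.mem_empty_iff_false, iff_false, not_le]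
        positivity
      rw [hemp, measureReal_empty]
      positivity
    · refine (H₂ (b := fun i => a i * L i) (fun i => hD₂ (hVexp i)) (fun i => hcenter (hVi i))
        hV'ind hσ hB (sum_mul_sq_le_weightedTwoNorm_sq a L hL) (by positivity)).trans ?_
      gcongr K₂ * ?_
      refine hmono (min_le_right _ _) ?_
      have hr : x / σ / (B / σ) = x / B := by field_simp
      rw [hh, gboExp, if_neg (by positivity), hr, ← min_div_div_right (by norm_num)]
      refine min_le_min (le_of_eq (by ring)) ?_
      change _ ≤ (x / 8 / B) ^ α
      have h8 : (8 : ℝ) ^ α ≤ 64 :=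
        calc (8 : ℝ) ^ α ≤ 8 ^ (2 : ℝ) := Real.rpow_le_rpow_of_exponent_le (by norm_num) hα2
          _ = 64 := by norm_num
      rw [show x / 8 / B = x / B / 8 by ring, Real.div_rpow (div_pos hx hB).le (by norm_num)]
      exact div_le_div_of_nonneg_left (Real.rpow_nonneg (div_pos hx hB).le _) (by positivity) h8
  calc _ ≤ _ := measureReal_mono hsub
    _ ≤ _ := measureReal_union_le _ _
    _ ≤ _ := by linarith

lemma exists_subWeibullTuple_tail_of_two_le {α : ℝ} (hα2 : 2 ≤ α) :
    ∃ K c : ℝ, 0 < c ∧ ∀ {Ω : Type u} [MeasurableSpace Ω] {P : Measure Ω}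
      [IsProbabilityMeasure P] {n : ℕ} {a L : Fin n → ℝ} {X : Fin n → Ω → ℝ},
      (∀ i, 0 ≤ L i) → SubWeibullTuple α L X P → 0 < weightedTwoNorm a L → ∀ x, 0 < x →
      P.real {ω | x ≤ |∑ i, a i * X i ω|} ≤ K * Real.exp (-(c *
        gboExp α (weightedBetaNorm α a L / weightedTwoNorm a L) (x / weightedTwoNorm a L))) := by
  have hα : 0 < α := by linarith
  obtain ⟨c, hc, H⟩ := exists_subgaussian_tail.{u} (Real.exp 1 + 2)
  refine ⟨2, c / 4, by positivity, ?_⟩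
  intro Ω _ P _ n a L X hL hX hσ x hx
  have hXm := fun i => (hX.mem i).measurable
  have hl : ∀ i, 1 ≤ max 1 (L i) := fun i => le_max_left _ _
  have hl0 : ∀ i, 0 < max 1 (L i) := fun i => zero_lt_one.trans_le (hl i)
  -- With `y = |X_i| / 2`: for `y ≤ L̄_i` the exponent is at most `1`, whence `exp 1`; beyond, `α ≥
  -- 2` puts `(y / L̄_i) ^ 2` below both terms of the minimum, whence `2`.
  have hexp : ∀ i, HasExpMoment 2 (Real.exp 1 + 2) (fun ω => X i ω / 2 / max 1 (L i)) P := by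
    intro i
    obtain ⟨h1, h2⟩ := (hX.mem i).integral_exp_gboExp_le hα (hL i)
    refine HasExpMoment.of_le (by fun_prop) ((integrable_const (Real.exp 1)).add h1) ?_ fun ω => ?_
    · simp only [Pi.add_apply]
      rw [integral_add (integrable_const _) h1]
      simpa using h2
    · simp only [Pi.add_apply]
      set y := |X i ω| / 2 with hy
      have habs : |X i ω / 2 / max 1 (L i)| = y / max 1 (L i) := by
        rw [abs_div, abs_div, abs_two, abs_of_pos (hl0 i)]
      rw [habs, Real.rpow_two]
      have hy0 : 0 ≤ y := by positivity
      rcases le_total y (max 1 (L i)) with hc1 | hc1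
      · have : (y / max 1 (L i)) ^ 2 ≤ 1 :=
          pow_le_one₀ (by have := hl0 i; positivity) ((div_le_one (hl0 i)).2 hc1)
        have h3 := Real.exp_le_exp.2 this
        have := Real.exp_pos (gboExp α (L i) y)
        linarith
      · have h3 : (y / max 1 (L i)) ^ 2 ≤ gboExp α (L i) y := by
          have h4 : (y / max 1 (L i)) ^ 2 ≤ y ^ 2 := by
            have := hl0 i
            gcongr
            exact div_le_self hy0 (hl i)
          unfold gboExp
          split_ifs with h0
          · exact h4
          · have hLi : 0 < L i := lt_of_le_of_ne (hL i) (Ne.symm h0)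
            refine le_min h4 ?_
            have h5 : 1 ≤ y / max 1 (L i) := (one_le_div (hl0 i)).2 hc1
            calc (y / max 1 (L i)) ^ 2 = (y / max 1 (L i)) ^ (2 : ℝ) := (Real.rpow_two _).symm
              _ ≤ (y / max 1 (L i)) ^ α := Real.rpow_le_rpow_of_exponent_le h5 hα2
              _ ≤ _ := by gcongr; exact le_max_right _ _
        have h6 := Real.exp_le_exp.2 h3
        have := Real.exp_pos 1
        linarith
  have h := H (b := fun i => a i * max 1 (L i)) hexp
    (fun i => by rw [integral_div, integral_div, (hX.mem i).mean_zero]; simp)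
    (hX.indep.comp (fun i y => y / 2 / max 1 (L i)) fun i => by fun_prop) hσ
    (weightedTwoNorm_sq a L).ge (half_pos hx)
  have hsum : ∀ ω, ∑ i, a i * max 1 (L i) * (X i ω / 2 / max 1 (L i))
      = (∑ i, a i * X i ω) / 2 := fun ω => by
    rw [Finset.sum_div]
    refine Finset.sum_congr rfl fun i _ => ?_
    have := (hl0 i).ne'
    field_simp
  have hset : {ω | x ≤ |∑ i, a i * X i ω|}
      = {ω | x / 2 ≤ |∑ i, a i * max 1 (L i) * (X i ω / 2 / max 1 (L i))|} := by
    ext ω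
    simp only [Set.mem_ofPred_eq, hsum, abs_div, abs_two]
    constructor <;> intro h <;> linarith
  rw [hset]
  refine h.trans ?_
  gcongr 2 * Real.exp (-?_)
  calc _ ≤ c / 4 * (x / weightedTwoNorm a L) ^ 2 := by gcongr; exact gboExp_le_sq
    _ = _ := by ring

/-- The upper bound: it holds for all large enough constants. -/
lemma exists_supGBONorm_le {α : ℝ} (hα : 0 < α) :
    ∃ C₀ : ℝ, 0 < C₀ ∧ ∀ C, C₀ ≤ C → ∀ (n : ℕ) (a L : Fin n → ℝ), (∀ i, 0 ≤ L i) →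
      0 < weightedTwoNorm a L →
      supGBONorm.{u} α a L (C * weightedBetaNorm α a L / weightedTwoNorm a L)
        ≤ ENNReal.ofReal (C * weightedTwoNorm a L) := by
  obtain ⟨K, c, hc, H⟩ : ∃ K c : ℝ, 0 < c ∧ ∀ {Ω : Type u} [MeasurableSpace Ω] {P : Measure Ω}
      [IsProbabilityMeasure P] {n : ℕ} {a L : Fin n → ℝ} {X : Fin n → Ω → ℝ},
      (∀ i, 0 ≤ L i) → SubWeibullTuple α L X P → 0 < weightedTwoNorm a L → ∀ x, 0 < x →
      P.real {ω | x ≤ |∑ i, a i * X i ω|} ≤ K * Real.exp (-(c *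
        gboExp α (weightedBetaNorm α a L / weightedTwoNorm a L) (x / weightedTwoNorm a L))) := by
    rcases le_total α 2 with h | h
    · exact exists_subWeibullTuple_tail_of_le_two hα h
    · exact exists_subWeibullTuple_tail_of_two_le h
  obtain ⟨C₀, hC₀, H'⟩ := exists_orliczNorm_le.{u} hα K hc
  refine ⟨C₀, hC₀, fun C hC n a L hL hσ => sSup_le ?_⟩
  rintro v ⟨Ω, _, P, _, X, hX, rfl⟩
  have hXm := fun i => (hX.mem i).measurable
  rw [mul_div_assoc]
  exact H' C hC (by fun_prop) (div_nonneg (vecNorm_betaExp_nonneg _) hσ.le) hσ (H hL hX hσ)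

/-! ### Symmetric three-point laws -/

/-- The law with mass `1 - p` at `0` and mass `p / 2` at each of `v` and `-v`. -/
noncomputable def threePoint (p v : ℝ) : Measure ℝ :=
  ENNReal.ofReal (1 - p) • Measure.dirac 0
    + ENNReal.ofReal (p / 2) • (Measure.dirac v + Measure.dirac (-v))

section

variable {p v : ℝ}

lemma isProbabilityMeasure_threePoint (hp0 : 0 ≤ p) (hp1 : p ≤ 1) :
    IsProbabilityMeasure (threePoint p v) := by
  refine ⟨?_⟩
  simp only [threePoint, Measure.add_apply, Measure.smul_apply, measure_univ, smul_eq_mul, mul_one]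
  rw [one_add_one_eq_two, ← ENNReal.ofReal_ofNat 2, ← ENNReal.ofReal_mul (by positivity),
    ← ENNReal.ofReal_add (by linarith) (by positivity)]
  simp

lemma lintegral_threePoint (f : ℝ → ℝ≥0∞) :
    ∫⁻ x, f x ∂threePoint p v
      = ENNReal.ofReal (1 - p) * f 0 + ENNReal.ofReal (p / 2) * (f v + f (-v)) := by
  simp [threePoint, mul_add]

lemma integrable_threePoint (f : ℝ → ℝ) : Integrable f (threePoint p v) := by
  have h : ∀ x : ℝ, Integrable f (Measure.dirac x) := fun x => integrable_dirac (by simp)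
  exact ((h 0).smul_measure ENNReal.ofReal_ne_top).add_measure
    (((h v).add_measure (h (-v))).smul_measure ENNReal.ofReal_ne_top)

lemma integral_threePoint (hp0 : 0 ≤ p) (hp1 : p ≤ 1) (f : ℝ → ℝ) :
    ∫ x, f x ∂threePoint p v = (1 - p) * f 0 + p / 2 * (f v + f (-v)) := by
  have h : ∀ x : ℝ, Integrable f (Measure.dirac x) := fun x => integrable_dirac (by simp)
  rw [threePoint, integral_add_measure ((h 0).smul_measure ENNReal.ofReal_ne_top)
    (((h v).add_measure (h (-v))).smul_measure ENNReal.ofReal_ne_top), integral_smul_measure,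
    integral_smul_measure, integral_add_measure (h v) (h (-v)), integral_dirac, integral_dirac,
    integral_dirac, ENNReal.toReal_ofReal (by linarith), ENNReal.toReal_ofReal (by positivity)]
  simp

lemma le_threePoint_singleton {y : ℝ} (hy : y = v ∨ y = -v) :
    ENNReal.ofReal (p / 2) ≤ threePoint p v {y} := by
  have h : (1 : ℝ≥0∞) ≤ (Measure.dirac v + Measure.dirac (-v)) {y} := by
    rw [Measure.add_apply]
    rcases hy with rfl | rfl
    · simp
    · simp
  calc ENNReal.ofReal (p / 2) = ENNReal.ofReal (p / 2) * 1 := (mul_one _).symm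
    _ ≤ ENNReal.ofReal (p / 2) * (Measure.dirac v + Measure.dirac (-v)) {y} := by gcongr
    _ ≤ _ := by
      simp only [threePoint, Measure.add_apply, Measure.smul_apply, smul_eq_mul]
      exact le_add_self

end

/-- Independent variables with prescribed laws, on a probability space in any universe. -/
lemma exists_iIndepFun_map_eq {n : ℕ} (μ : Fin n → Measure ℝ)
    [∀ i, IsProbabilityMeasure (μ i)] :
    ∃ (Ω : Type u) (_ : MeasurableSpace Ω) (P : Measure Ω) (_ : IsProbabilityMeasure P)
      (X : Fin n → Ω → ℝ), (∀ i, Measurable (X i)) ∧ (∀ i, P.map (X i) = μ i) ∧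
        iIndepFun X P := by
  have hup : Measurable (ULift.up.{u} : ℝ → ULift.{u} ℝ) := measurable_up
  have hdown : Measurable (ULift.down.{u} : ULift.{u} ℝ → ℝ) := measurable_down
  have : ∀ i, IsProbabilityMeasure ((μ i).map (ULift.up.{u})) := fun i =>
    Measure.isProbabilityMeasure_map hup.aemeasurable
  refine ⟨Fin n → ULift.{u} ℝ, inferInstance, Measure.pi fun i => (μ i).map ULift.up,
    inferInstance, fun i ω => (ω i).down, fun i => hdown.comp (measurable_pi_apply i),
    fun i => ?_, iIndepFun_pi fun i => hdown.aemeasurable⟩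
  have h := (measurePreserving_eval (fun i => (μ i).map (ULift.up.{u})) i).map_eq
  change Measure.map (ULift.down.{u} ∘ (Function.eval i : (Fin n → ULift.{u} ℝ) → _)) _ = _
  rw [← Measure.map_map hdown (measurable_pi_apply i), h, Measure.map_map hdown hup]
  exact Measure.map_id

lemma isSubWeibull_of_map_eq_threePoint {Ω : Type u} [MeasurableSpace Ω] {P : Measure Ω}
    {X : Ω → ℝ} {α L p v : ℝ} (hX : Measurable X) (hmap : P.map X = threePoint p v)
    (hL : 0 ≤ L) (hp0 : 0 ≤ p) (hp1 : p ≤ 1) (hv : 0 ≤ v)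
    (h : p * gboFun α L v ≤ 1) : IsSubWeibull α L 1 X P := by
  refine ⟨hX, ?_, ?_, orliczNorm_le one_pos ?_⟩
  · exact (integrable_map_measure (f := X) (g := id) measurable_id.aestronglyMeasurable
      hX.aemeasurable).1 (hmap ▸ integrable_threePoint _)
  · have := integral_map (μ := P) (f := fun x : ℝ => x) hX.aemeasurable
      measurable_id.aestronglyMeasurable
    rw [← this, hmap, integral_threePoint hp0 hp1]
    ring
  · have hg : Measurable fun x : ℝ => ENNReal.ofReal (gboFun α L (|x| / 1)) := by
      simp only [gboFun_eq]; fun_prop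
    rw [← lintegral_map hg hX, hmap, lintegral_threePoint]
    have h0 : gboFun α L 0 = 0 := by
      rw [gboFun_eq, sub_eq_zero, Real.exp_eq_one_iff]
      exact le_antisymm (gboExp_le_sq.trans (by simp)) (gboExp_nonneg hL le_rfl)
    rw [abs_neg, abs_of_nonneg hv, div_one, div_one, abs_zero, h0, ENNReal.ofReal_zero, mul_zero,
      zero_add, ← two_mul, ← ENNReal.ofReal_ofNat 2, ← ENNReal.ofReal_mul (by positivity),
      ← ENNReal.ofReal_mul (by positivity)]
    refine ENNReal.ofReal_le_one.2 (le_trans (le_of_eq ?_) h)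
    ring

/-! ### Lower bounds -/

/-- The lower bound when the target norm is the sub-Gaussian one: scaled Rademacher variables. -/
lemma exists_le_supGBONorm_of_gboExp_eq_sq {α : ℝ} (hα : 0 < α) :
    ∃ C₀ : ℝ, 0 < C₀ ∧ ∀ C, C₀ ≤ C → ∀ (n : ℕ) (a L : Fin n → ℝ) (M : ℝ), (∀ i, 0 ≤ L i) →
      0 < weightedTwoNorm a L → 0 ≤ M → (∀ x, 0 ≤ x → gboExp α M x = x ^ 2) →
      ENNReal.ofReal (weightedTwoNorm a L / C) ≤ supGBONorm.{u} α a L M := by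
  -- Chosen so that the exponent at `c L̄_i` is at most `1 / 2`, by the quadratic term if `L_i ≤ 1`
  -- and by the Weibull term otherwise; then `exp (1 / 2) < 2` gives membership in the class.
  set c : ℝ := min (1 / 2) ((1 / 2) ^ (1 / α)) with hc
  have hc0 : 0 < c := by positivity
  refine ⟨2 / c, by positivity, ?_⟩
  intro C hC n a L M hL hσ hM hsq
  have hC0 : 0 < C := lt_of_lt_of_le (by positivity) hC
  set σ := weightedTwoNorm a L with hσdef
  have hl0 : ∀ i, 0 < max 1 (L i) := fun i => zero_lt_one.trans_le (le_max_left _ _)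
  set v : Fin n → ℝ := fun i => c * max 1 (L i) with hv
  have hv0 : ∀ i, 0 ≤ v i := fun i => by have := hl0 i; positivity
  have hprob : ∀ i, IsProbabilityMeasure (threePoint 1 (v i)) := fun i =>
    isProbabilityMeasure_threePoint zero_le_one le_rfl
  obtain ⟨Ω, _, P, _, X, hXm, hmap, hind⟩ :=
    exists_iIndepFun_map_eq.{u} fun i => threePoint 1 (v i)
  have hexp : ∀ i, gboExp α (L i) (v i) ≤ 1 / 2 := fun i => by
    rcases le_or_gt (L i) 1 with h | h
    · refine gboExp_le_sq.trans ?_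
      rw [hv]
      simp only
      rw [max_eq_left h, mul_one]
      have := min_le_left (1 / 2 : ℝ) ((1 / 2) ^ (1 / α))
      nlinarith
    · rw [gboExp, if_neg (by linarith), hv]
      simp only
      rw [max_eq_right h.le]
      refine (min_le_right _ _).trans ?_
      rw [mul_div_cancel_right₀ _ (by linarith)]
      calc c ^ α ≤ ((1 / 2) ^ (1 / α)) ^ α := by gcongr; exact min_le_right _ _
        _ = 1 / 2 := by
          rw [← Real.rpow_mul (by positivity), one_div_mul_cancel hα.ne', Real.rpow_one]
  have hsub : ∀ i, IsSubWeibull α (L i) 1 (X i) P := fun i => by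
    refine isSubWeibull_of_map_eq_threePoint (hXm i) (hmap i) (hL i) zero_le_one le_rfl (hv0 i) ?_
    rw [gboFun_eq, one_mul]
    have h1 := Real.exp_le_exp.2 (hexp i)
    linarith [exp_half_lt]
  refine le_trans ?_ (le_sSup ⟨Ω, _, P, inferInstance, X, ⟨hsub, hind⟩, rfl⟩)
  refine le_orliczNorm hα hM ?_
  have hint : ∀ i (f : ℝ → ℝ), Measurable f → Integrable (fun ω => f (X i ω)) P := fun i f hf =>
    (integrable_map_measure (f := X i) (g := f) hf.aestronglyMeasurable (hXm i).aemeasurable).1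
      (hmap i ▸ integrable_threePoint _)
  have hLp : ∀ i, MemLp (fun ω => a i * X i ω) 2 P := fun i =>
    ((memLp_two_iff_integrable_sq (hXm i).aestronglyMeasurable).2
      (hint i (fun x => x ^ 2) (by fun_prop))).const_mul (a i)
  have hvar : Var[fun ω => ∑ i, a i * X i ω; P] = c ^ 2 * σ ^ 2 := by
    have hind' : iIndepFun (fun i ω => a i * X i ω) P :=
      hind.comp (fun i y => a i * y) fun i => by fun_prop
    have h := IndepFun.variance_sum (s := Finset.univ) (X := fun i ω => a i * X i ω)
      (fun i _ => hLp i) fun i _ j _ hij => hind'.indepFun hij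
    have hfun : (∑ i, fun ω => a i * X i ω) = fun ω => ∑ i, a i * X i ω := by
      ext ω; simp
    rw [hfun] at h
    rw [h, hσdef, weightedTwoNorm_sq, Finset.mul_sum]
    refine Finset.sum_congr rfl fun i _ => ?_
    rw [variance_const_mul, variance_of_integral_eq_zero (hXm i).aemeasurable (hsub i).mean_zero,
      ← integral_map (f := fun x : ℝ => x ^ 2) (hXm i).aemeasurable
        (by fun_prop : Measurable fun x : ℝ => x ^ 2).aestronglyMeasurable, hmap i,
      integral_threePoint zero_le_one le_rfl, hv]
    ring
  have hSLp : MemLp (fun ω => ∑ i, a i * X i ω) 2 P := memLp_finsetSum _ fun i _ => hLp i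
  have hSi := hSLp.integrable_sq
  have hmom : c ^ 2 * σ ^ 2 ≤ ∫ ω, (∑ i, a i * X i ω) ^ 2 ∂P :=
    hvar ▸ variance_le_expectation_sq hSLp.1
  calc (1 : ℝ≥0∞) < ENNReal.ofReal (C ^ 2 / σ ^ 2 * ∫ ω, (∑ i, a i * X i ω) ^ 2 ∂P) := by
        rw [ENNReal.one_lt_ofReal]
        calc (1 : ℝ) < (C * c) ^ 2 := by
              have : 2 ≤ C * c := (div_le_iff₀ hc0).1 hC
              nlinarith
          _ = C ^ 2 / σ ^ 2 * (c ^ 2 * σ ^ 2) := by field_simp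
          _ ≤ _ := by gcongr
    _ = ∫⁻ ω, ENNReal.ofReal (C ^ 2 / σ ^ 2 * (∑ i, a i * X i ω) ^ 2) ∂P := by
        rw [← integral_const_mul, ofReal_integral_eq_lintegral_ofReal (hSi.const_mul _)
          (Filter.Eventually.of_forall fun ω => by positivity)]
    _ ≤ _ := by
        refine lintegral_mono fun ω => ENNReal.ofReal_le_ofReal ?_
        rw [gboFun_eq, hsq _ (by positivity)]
        have := Real.add_one_le_exp ((|∑ i, a i * X i ω| / (σ / C)) ^ 2)
        have h2 : (|∑ i, a i * X i ω| / (σ / C)) ^ 2 = C ^ 2 / σ ^ 2 * (∑ i, a i * X i ω) ^ 2 := by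
          rw [div_pow, sq_abs, div_pow]; field_simp
        linarith

/-- For `s > 1` the gain `exp ((s ^ α - 1) t ^ α)` eventually beats any fixed `2 ^ n`. The last
inequality makes the Weibull term the active one at `t s M`: eventually if `α < 2`, always if `α =
2` and `M ≥ 1`. -/
lemma exists_heavy_scale {α s M : ℝ} (n : ℕ) (hα : 0 < α) (hs : 1 < s) (hM : 0 < M)
    (hαM : α < 2 ∨ α = 2 ∧ 1 ≤ M) :
    ∃ t : ℝ, 0 < t ∧ 1 < (1 / 2) ^ n * Real.exp (-t ^ α) * (Real.exp ((t * s) ^ α) - 1) ∧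
      (t * s) ^ α ≤ (t * s * M) ^ 2 := by
  have hκ : 0 < s ^ α - 1 := sub_pos.2 (Real.one_lt_rpow hs hα)
  have hlim : Filter.Tendsto (fun t : ℝ => Real.exp ((s ^ α - 1) * t ^ α)) Filter.atTop
      Filter.atTop :=
    Real.tendsto_exp_atTop.comp ((tendsto_rpow_atTop hα).const_mul_atTop hκ)
  have h2 : ∀ᶠ t : ℝ in Filter.atTop, (t * s) ^ α ≤ (t * s * M) ^ 2 := by
    rcases hαM with h | ⟨rfl, h⟩
    · have h3 : Filter.Tendsto (fun t : ℝ => (t * s) ^ (2 - α)) Filter.atTop Filter.atTop :=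
        (tendsto_rpow_atTop (by linarith)).comp
          (Filter.tendsto_id.atTop_mul_const (by linarith))
      filter_upwards [h3.eventually_ge_atTop (1 / M ^ 2), Filter.eventually_gt_atTop 0] with t ht ht0
      have hts : 0 < t * s := by positivity
      rw [div_le_iff₀ (by positivity)] at ht
      calc (t * s) ^ α = (t * s) ^ α * 1 := (mul_one _).symm
        _ ≤ (t * s) ^ α * ((t * s) ^ (2 - α) * M ^ 2) := by gcongr
        _ = (t * s) ^ (2 : ℝ) * M ^ 2 := by
            rw [← mul_assoc, ← Real.rpow_add hts]; congr 2; ring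
        _ = _ := by rw [Real.rpow_two, ← mul_pow]
    · filter_upwards with t
      rw [Real.rpow_two, mul_pow (t * s) M]
      exact le_mul_of_one_le_right (sq_nonneg _) (one_le_pow₀ h)
  obtain ⟨t, ht1, ht2, ht0⟩ := ((hlim.eventually_gt_atTop (2 ^ n + 1)).and
    (h2.and (Filter.eventually_gt_atTop 0))).exists
  refine ⟨t, ht0, ?_, ht2⟩
  have h4 : Real.exp (-t ^ α) * (Real.exp ((t * s) ^ α) - 1)
      = Real.exp ((s ^ α - 1) * t ^ α) - Real.exp (-t ^ α) := by
    rw [mul_sub, mul_one, ← Real.exp_add, Real.mul_rpow ht0.le (by linarith)]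
    congr 2; ring
  have h5 : Real.exp (-t ^ α) ≤ 1 := Real.exp_le_one_iff.2 (by
    have : 0 ≤ t ^ α := by positivity
    linarith)
  rw [mul_assoc, h4, one_div, inv_pow, ← div_eq_inv_mul, lt_div_iff₀ (by positivity)]
  linarith

/-- The lower bound when the heavy part of the target norm is effective: all variables are large
simultaneously, in the proportions dual to `a ⊙ L`. -/
lemma le_supGBONorm_of_weightedBetaNorm_pos {α C : ℝ} (hα : 0 < α) (hC : 0 < C) {n : ℕ}
    {a L : Fin n → ℝ} (hL : ∀ i, 0 ≤ L i) (hσ : 0 < weightedTwoNorm a L)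
    (hB : 0 < weightedBetaNorm α a L)
    (hαM : α < 2 ∨ α = 2 ∧ 1 ≤ C * weightedBetaNorm α a L / weightedTwoNorm a L) :
    ENNReal.ofReal (weightedTwoNorm a L / C) ≤
      supGBONorm.{u} α a L (C * weightedBetaNorm α a L / weightedTwoNorm a L) := by
  set σ := weightedTwoNorm a L
  set B := weightedBetaNorm α a L with hBdef
  set M := C * B / σ with hMdef
  have hM : 0 < M := by positivity
  -- Strictness leaves room for the ratio `s = σ / (C η) > 1`. The variables may depend on `η`,
  -- since only the supremum is bounded.
  suffices H : ∀ η, 0 < η → η < σ / C → ENNReal.ofReal η ≤ supGBONorm.{u} α a L M by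
    refine le_of_forall_lt fun z hz => ?_
    have hz1 : z ≠ ∞ := (hz.trans ENNReal.ofReal_lt_top).ne
    obtain ⟨η, h1, h2⟩ := exists_between ((ENNReal.lt_ofReal_iff_toReal_lt hz1).1 hz)
    exact ((ENNReal.lt_ofReal_iff_toReal_lt hz1).2 h1).trans_le
      (H η (ENNReal.toReal_nonneg.trans_lt h1) h2)
  intro η hη hησ
  have hs : 1 < σ / (C * η) := by
    rw [lt_div_iff₀ hC] at hησ
    rw [one_lt_div (by positivity)]
    linarith
  obtain ⟨t, ht, hmass, hquad⟩ := exists_heavy_scale n hα hs hM hαM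
  set s := σ / (C * η)
  obtain ⟨w, hw0, hwB, hwα⟩ := exists_sum_mul_eq_vecNorm_betaExp hα hB
  set v : Fin n → ℝ := fun i => L i * (t * w i) with hv
  set p : Fin n → ℝ := fun i => Real.exp (-(t * w i) ^ α) with hp
  have hv0 : ∀ i, 0 ≤ v i := fun i => mul_nonneg (hL i) (mul_nonneg ht.le (hw0 i))
  have hp0 : ∀ i, 0 ≤ p i := fun i => (Real.exp_pos _).le
  have hp1 : ∀ i, p i ≤ 1 := fun i => Real.exp_le_one_iff.2 (by
    have : 0 ≤ (t * w i) ^ α := Real.rpow_nonneg (mul_nonneg ht.le (hw0 i)) _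
    linarith)
  have hprob : ∀ i, IsProbabilityMeasure (threePoint (p i) (v i)) := fun i =>
    isProbabilityMeasure_threePoint (hp0 i) (hp1 i)
  obtain ⟨Ω, _, P, _, X, hXm, hmap, hind⟩ :=
    exists_iIndepFun_map_eq.{u} fun i => threePoint (p i) (v i)
  have hexp : ∀ i, gboExp α (L i) (v i) ≤ (t * w i) ^ α := fun i => by
    have hnn : 0 ≤ (t * w i) ^ α := Real.rpow_nonneg (mul_nonneg ht.le (hw0 i)) _
    by_cases h : L i = 0
    · refine gboExp_le_sq.trans ?_
      simpa [hv, h] using hnn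
    · rw [gboExp, if_neg h, hv]
      simp only
      rw [mul_div_cancel_left₀ _ h]
      exact min_le_right _ _
  have hsub : ∀ i, IsSubWeibull α (L i) 1 (X i) P := fun i => by
    refine isSubWeibull_of_map_eq_threePoint (hXm i) (hmap i) (hL i) (hp0 i) (hp1 i) (hv0 i) ?_
    rw [gboFun_eq]
    calc p i * (Real.exp (gboExp α (L i) (v i)) - 1)
        ≤ p i * Real.exp ((t * w i) ^ α) := by
          refine mul_le_mul_of_nonneg_left ?_ (hp0 i)
          linarith [Real.exp_le_exp.2 (hexp i)]
      _ = 1 := by rw [hp]; simp only; rw [← Real.exp_add, neg_add_cancel, Real.exp_zero]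
  refine le_trans ?_ (le_sSup ⟨Ω, _, P, inferInstance, X, ⟨hsub, hind⟩, rfl⟩)
  refine le_orliczNorm hα hM.le ?_
  -- The signs align with those of `a`, so that on `E` the sum is `t ∑ |a_i L_i| w_i = t B`.
  set y : Fin n → ℝ := fun i => if 0 ≤ a i then v i else -v i with hy
  set E : Set Ω := ⋂ i, X i ⁻¹' {y i} with hE
  have hEm : MeasurableSet E :=
    MeasurableSet.iInter fun i => hXm i (measurableSet_singleton _)
  have hPE : ENNReal.ofReal ((1 / 2) ^ n * Real.exp (-t ^ α)) ≤ P E := by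
    rw [hE, hind.meas_iInter fun i => ⟨{y i}, measurableSet_singleton _, rfl⟩]
    calc ENNReal.ofReal ((1 / 2) ^ n * Real.exp (-t ^ α)) ≤ ENNReal.ofReal (∏ i, p i / 2) := by
          refine ENNReal.ofReal_le_ofReal ?_
          have h1 : ∏ i, p i / 2 = (1 / 2) ^ n * Real.exp (∑ i, -(t * w i) ^ α) := by
            rw [Real.exp_sum, Finset.prod_div_distrib, Finset.prod_const, Finset.card_univ,
              Fintype.card_fin, one_div, inv_pow, inv_mul_eq_div]
          rw [h1]
          gcongr
          rw [Finset.sum_neg_distrib, neg_le_neg_iff]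
          calc ∑ i, (t * w i) ^ α = t ^ α * ∑ i, w i ^ α := by
                rw [Finset.mul_sum]
                exact Finset.sum_congr rfl fun i _ => Real.mul_rpow ht.le (hw0 i)
            _ ≤ t ^ α * 1 := by gcongr
            _ = t ^ α := mul_one _
      _ = ∏ i, ENNReal.ofReal (p i / 2) :=
          ENNReal.ofReal_prod_of_nonneg fun i _ => div_nonneg (hp0 i) zero_le_two
      _ ≤ ∏ i, P (X i ⁻¹' {y i}) := by
          refine Finset.prod_le_prod' fun i _ => ?_
          rw [← Measure.map_apply (hXm i) (measurableSet_singleton _), hmap i]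
          refine le_threePoint_singleton ?_
          simp only [hy]
          split_ifs
          · exact Or.inl rfl
          · exact Or.inr rfl
  have hval : ∀ ω ∈ E, gboFun α M (|∑ i, a i * X i ω| / η) = Real.exp ((t * s) ^ α) - 1 := by
    intro ω hω
    have hXy : ∀ i, X i ω = y i := fun i => Set.mem_iInter.1 hω i
    have hS : ∑ i, a i * X i ω = t * B := by
      rw [hBdef, weightedBetaNorm, ← hwB, Finset.mul_sum]
      refine Finset.sum_congr rfl fun i _ => ?_
      rw [hXy, abs_mul, abs_of_nonneg (hL i)]
      simp only [hy, hv]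
      split_ifs with h
      · rw [abs_of_nonneg h]; ring
      · rw [abs_of_neg (not_le.1 h)]; ring
    have harg : |∑ i, a i * X i ω| / η = t * s * M := by
      rw [hS, abs_of_pos (by positivity), hMdef]
      simp only [s]
      field_simp
    rw [gboFun_eq, harg, gboExp, if_neg hM.ne', mul_div_cancel_right₀ _ hM.ne', min_eq_right hquad]
  calc (1 : ℝ≥0∞) < ENNReal.ofReal
        ((1 / 2) ^ n * Real.exp (-t ^ α) * (Real.exp ((t * s) ^ α) - 1)) :=
        ENNReal.one_lt_ofReal.2 hmass
    _ = ENNReal.ofReal (Real.exp ((t * s) ^ α) - 1) *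
          ENNReal.ofReal ((1 / 2) ^ n * Real.exp (-t ^ α)) := by
        rw [ENNReal.ofReal_mul (by positivity), mul_comm]
    _ ≤ ENNReal.ofReal (Real.exp ((t * s) ^ α) - 1) * P E := by gcongr
    _ = ∫⁻ ω in E, ENNReal.ofReal (gboFun α M (|∑ i, a i * X i ω| / η)) ∂P := by
        rw [setLIntegral_congr_fun hEm fun ω hω => by rw [hval ω hω], setLIntegral_const]
    _ ≤ _ := setLIntegral_le_lintegral _ _

theorem theorem2 (α : ℝ) (hα : 0 < α) :
    ∃ C : ℝ, 0 < C ∧ ∀ (n : ℕ) (a L : Fin n → ℝ), (∀ i, 0 ≤ L i) →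
      supGBONorm.{u} α a L (C * weightedBetaNorm α a L / weightedTwoNorm a L)
          ≤ ENNReal.ofReal (C * weightedTwoNorm a L) ∧
      (α ≤ 2 →
        ENNReal.ofReal (1 / C * weightedTwoNorm a L)
          ≤ supGBONorm.{u} α a L (C * weightedBetaNorm α a L / weightedTwoNorm a L)) := by
  obtain ⟨C₁, hC₁, hupper⟩ := exists_supGBONorm_le.{u} hα
  obtain ⟨C₂, hC₂, hlower⟩ := exists_le_supGBONorm_of_gboExp_eq_sq.{u} hα
  set C := max C₁ C₂
  have hC : 0 < C := by positivity
  refine ⟨C, hC, fun n a L hL => ?_⟩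
  -- If `σ = 0` then `a = 0`, and division by zero yields `0`, the prescribed value of `L*`; every
  -- positive scale is then admissible.
  rcases (vecNorm_two_nonneg fun i => a i * max 1 (L i)).eq_or_lt with hσ | hσ
  · have hσ' : weightedTwoNorm a L = 0 := hσ.symm
    have ha : ∀ i, a i = 0 := fun i => by
      have h := sum_sq_le_weightedTwoNorm_sq a L
      rw [hσ', zero_pow two_ne_zero] at h
      have h2 := (Finset.sum_eq_zero_iff_of_nonneg fun i _ => sq_nonneg (a i)).1
        (le_antisymm h (Finset.sum_nonneg fun i _ => sq_nonneg (a i))) i (Finset.mem_univ i)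
      exact pow_eq_zero_iff two_ne_zero |>.1 h2
    rw [hσ', div_zero, mul_zero, mul_zero, ENNReal.ofReal_zero]
    refine ⟨sSup_le ?_, fun _ => zero_le⟩
    rintro v ⟨Ω, _, P, _, X, hX, rfl⟩
    refine ENNReal.le_of_forall_pos_le_add fun ε hε _ => ?_
    have h := orliczNorm_le (P := P) (g := gboFun α 0) (X := fun ω => ∑ i, a i * X i ω)
      (NNReal.coe_pos.2 hε) (by simp [ha, gboFun])
    simpa using h
  · change 0 < weightedTwoNorm a L at hσ
    refine ⟨hupper C (le_max_left _ _) n a L hL hσ, fun hα2 => ?_⟩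
    rw [one_div_mul_eq_div]
    have hB0 : 0 ≤ weightedBetaNorm α a L := vecNorm_betaExp_nonneg _
    set M := C * weightedBetaNorm α a L / weightedTwoNorm a L with hM
    have hM0 : 0 ≤ M := by positivity
    rcases hB0.eq_or_lt with hB | hB
    · refine hlower C (le_max_right _ _) n a L M hL hσ hM0 fun x _ => ?_
      rw [gboExp, if_pos (by rw [hM, ← hB, mul_zero, zero_div])]
    -- At `α = 2` both terms of the minimum are quadratic: the Weibull one is active if `M ≥ 1`, the
    -- Gaussian one everywhere if `M < 1`.
    · by_cases hcase : α < 2 ∨ α = 2 ∧ 1 ≤ M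
      · exact le_supGBONorm_of_weightedBetaNorm_pos hα hC hL hσ hB hcase
      · push Not at hcase
        obtain rfl : α = 2 := le_antisymm hα2 hcase.1
        have hM1 := hcase.2 rfl
        have hMpos : 0 < M := by positivity
        refine hlower C (le_max_right _ _) n a L M hL hσ hM0 fun x hx => ?_
        rw [gboExp, if_neg hMpos.ne', Real.rpow_two]
        refine min_eq_left ?_
        gcongr
        exact le_div_self hx hMpos hM1.le
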